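/- Let $(\Omega,\mathcal F,\mathbb P)$ be a probability space with a discrete time filtration $(\mathcal F_k)_{k\ge 0}$ such that for each $k\ge 1$ there is an $\mathcal F_k$-measurable random variable $U_k$, uniformly distributed on $[0,1]$ and independent of $\mathcal F_{k-1}$. Write $\|\xi\|=(\mathbb E|\xi|^2)^{1/2}$ for $\mathbb R^m$-valued $\xi$, $|\cdot|$ being the Euclidean norm. Let $(X_k)_{k\ge 0}$, $X_0=0$, be an $\mathbb R^m$-valued martingale with $\sup_k\|X_k\|<\infty$. Then there is a square integrable $X_\infty$ such that $X_k\to X_\infty$ in $L^2$ and almost surely, and $X_k=\mathbb E[X_\infty\mid\mathcal F_k]$ for all $k$. Call an array $(Y^n_k)_{n\ge 1,k\ge 1}$ of random variables an independent expansion of the increments of $X$ if, for all $k\ge1$: each $Y^n_k$ is $\mathcal F_k$-measurable, square integrable and independent of $\mathcal F_{k-1}$, with $\mathbb E[Y^n_k\mid\mathcal F_{k-1}]=0$; $X_k-X_{k-1}=\sum_n Y^n_k$ in $L^2$; and for all $N\ge 0$ $$\|X_k-X_{k-1}\|^2=\Big\|X_k-X_{k-1}-\sum_{n\le N}Y^n_k\Big\|^2+\sum_{n\le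 N}\|Y^n_k\|^2 .$$ (a) Such an expansion exists. Moreover, whenever an array $(Y^n_k)$ is obtained by successive best approximation, i.e. for all $n,k\ge 1$ the variable $Y^n_k$ minimises $\|X_k-X_{k-1}-\sum_{i<n}Y^i_k-\zeta\|$ over all $\mathcal F_k$-measurable $\mathbb R^m$-valued $\zeta$ that are independent of $\mathcal F_{k-1}$ (and is itself such a variable), it is such an expansion. (b) Let $(Y^n_k)$ be any such expansion and put $Z^n_0=0$, $Z^n_k=\sum_{s=1}^k Y^n_s$. Then each $Z^n$ is a square integrable martingale, $Z^n_k-Z^n_{k-1}$ is independent of $\mathcal F_{k-1}$ for all $k\ge1$, for each $n$ the increments $(Z^n_k-Z^n_{k-1})_{k\ge 1}$ form an independent system, $X_k=\sum_n Z^n_k$ in $L^2$ and $\|X_k\|^2=\sum_n\|Z^n_k\|^2$ for all $k$. Each $Z^n$ is $L^2$-bounded and has a square integrable limit $Z^n_\infty$, in $L^2$ and almost surely, with $Z^n_k=\mathbb E[Z^n_\infty\mid\mathcal F_k]$. Moreover $$X_\infty=\sum_n Z^n_\infty\quad\text{in }L^2,\qquad \|X_\infty\|^2=\sum_n\|Z^n_\infty\|^2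 .$$ -/

import Mathlib

open MeasureTheory ProbabilityTheory Filter Topology
open scoped NNReal ENNReal

/-- The `L²`-norm `‖f‖ = (𝔼|f|²)^{1/2}` of an `ℝᵐ`-valued random variable, `|·|` Euclidean. It is
only used for square integrable `f`. -/
noncomputable def l2norm {Ω : Type*} {mΩ : MeasurableSpace Ω} {m : ℕ} (μ : Measure Ω)
    (f : Ω → EuclideanSpace ℝ (Fin m)) : ℝ :=
  (eLpNorm f 2 μ).toReal

/-- The random variable `f` is independent of the sigma-algebra `A`. -/
def IndepOf {Ω : Type*} {mΩ : MeasurableSpace Ω} {β : Type*} [mβ : MeasurableSpace β]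
    (μ : Measure Ω) (f : Ω → β) (A : MeasurableSpace Ω) : Prop :=
  Indep (MeasurableSpace.comap f mβ) A μ

/-- The filtration has atomless innovations: for each `k ≥ 1` there is an `ℱ_k`-measurable random
variable, uniformly distributed on `[0,1]` and independent of `ℱ_{k-1}`. -/
def HasAtomlessInnovations {Ω : Type*} {mΩ : MeasurableSpace Ω} (μ : Measure Ω)
    (ℱ : Filtration ℕ mΩ) : Prop :=
  ∀ k : ℕ, ∃ U : Ω → ℝ, Measurable[ℱ (k + 1)] U ∧
    μ.map U = volume.restrict (Set.Icc (0 : ℝ) 1) ∧ IndepOf μ U (ℱ k)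

/-- `sup_k ‖X_k‖ < ∞`. -/
def L2Bounded {Ω : Type*} {mΩ : MeasurableSpace Ω} {m : ℕ} (μ : Measure Ω)
    (X : ℕ → Ω → EuclideanSpace ℝ (Fin m)) : Prop :=
  ∃ C : ℝ≥0, ∀ k, eLpNorm (X k) 2 μ ≤ C

/-- `x` is the terminal value `X_∞` of the process `X`: it is square integrable, `X_k → x` in `L²`
and almost surely, and `X_k = 𝔼[x | ℱ_k]`. -/
structure IsTerminalValue {Ω : Type*} {mΩ : MeasurableSpace Ω} {m : ℕ} (μ : Measure Ω)
    (ℱ : Filtration ℕ mΩ) (X : ℕ → Ω → EuclideanSpace ℝ (Fin m))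
    (x : Ω → EuclideanSpace ℝ (Fin m)) : Prop where
  memLp : MemLp x 2 μ
  tendsto_l2 : Tendsto (fun k => eLpNorm (X k - x) 2 μ) atTop (𝓝 0)
  tendsto_ae : ∀ᵐ ω ∂μ, Tendsto (fun k => X k ω) atTop (𝓝 (x ω))
  condExp_eq : ∀ k, μ[x | ℱ k] =ᵐ[μ] X k

/-- `s = ∑_n f_n` with convergence (of the partial sums) in `L²`. -/
def HasL2Sum {Ω : Type*} {mΩ : MeasurableSpace Ω} {m : ℕ} (μ : Measure Ω)
    (f : ℕ → Ω → EuclideanSpace ℝ (Fin m)) (s : Ω → EuclideanSpace ℝ (Fin m)) : Prop :=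
  Tendsto (fun N => eLpNorm (s - ∑ n ∈ Finset.range N, f n) 2 μ) atTop (𝓝 0)

/-- Among the `G`-measurable random variables that are independent of `A`, `η` is a best
`L²`-approximation of `ξ`. -/
structure IsBestIndepApprox {Ω : Type*} {mΩ : MeasurableSpace Ω} {m : ℕ} (μ : Measure Ω)
    (A G : MeasurableSpace Ω) (ξ η : Ω → EuclideanSpace ℝ (Fin m)) : Prop where
  stronglyMeasurable : StronglyMeasurable[G] η
  indep : IndepOf μ η A
  le : ∀ ζ : Ω → EuclideanSpace ℝ (Fin m), StronglyMeasurable[G] ζ → IndepOf μ ζ A →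
    eLpNorm (ξ - η) 2 μ ≤ eLpNorm (ξ - ζ) 2 μ

/-- The sequence `η` is obtained from `ξ` by successive best approximation: `ξ_0 = ξ`, `η_n` is a
best `L²`-approximation of `ξ_n` independent of `A`, and `ξ_{n+1} = ξ_n - η_n`
(so that `ξ_n = ξ - ∑_{i<n} η_i`). -/
def IsGreedyExpansion {Ω : Type*} {mΩ : MeasurableSpace Ω} {m : ℕ} (μ : Measure Ω)
    (A G : MeasurableSpace Ω) (ξ : Ω → EuclideanSpace ℝ (Fin m))
    (η : ℕ → Ω → EuclideanSpace ℝ (Fin m)) : Prop :=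
  ∀ n, IsBestIndepApprox μ A G (ξ - ∑ i ∈ Finset.range n, η i) (η n)

/-- `ξ = ∑_n η_n` in `L²`, where the `η_n` are `G`-measurable, square integrable, independent of
`A`, conditionally centred, and `‖ξ‖² = ‖ξ - ∑_{i<n} η_i‖² + ∑_{i<n} ‖η_i‖²` for all `n`. -/
structure IsIndepExpansion {Ω : Type*} {mΩ : MeasurableSpace Ω} {m : ℕ} (μ : Measure Ω)
    (A G : MeasurableSpace Ω) (ξ : Ω → EuclideanSpace ℝ (Fin m))
    (η : ℕ → Ω → EuclideanSpace ℝ (Fin m)) : Prop where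
  stronglyMeasurable : ∀ n, StronglyMeasurable[G] (η n)
  memLp : ∀ n, MemLp (η n) 2 μ
  indep : ∀ n, IndepOf μ (η n) A
  condExp_eq_zero : ∀ n, μ[η n | A] =ᵐ[μ] 0
  norm_sq : ∀ n, l2norm μ ξ ^ 2 =
    l2norm μ (ξ - ∑ i ∈ Finset.range n, η i) ^ 2 + ∑ i ∈ Finset.range n, l2norm μ (η i) ^ 2
  hasL2Sum : HasL2Sum μ η ξ

/-- `Z_k = ∑_{1 ≤ s ≤ k} Y_s`; in particular `Z_0 = 0`, and the value `Y_0` is not used. -/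
def sumProcess {Ω : Type*} {m : ℕ} (Y : ℕ → Ω → EuclideanSpace ℝ (Fin m)) :
    ℕ → Ω → EuclideanSpace ℝ (Fin m) :=
  fun k => ∑ s ∈ Finset.range k, Y (s + 1)

/-- The processes `Z^n` are martingales null at `0` with independent increments that sum up to the
martingale `X`: each `Z^n_k - Z^n_{k-1}` is independent of `ℱ_{k-1}`, for each `n` the increments
form an independent system, `X_k = ∑_n Z^n_k` in `L²` and `‖X_k‖² = ∑_n ‖Z^n_k‖²`. -/
structure IsIndepIncrementDecomposition {Ω : Type*} {mΩ : MeasurableSpace Ω} {m : ℕ}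
    (μ : Measure Ω) (ℱ : Filtration ℕ mΩ) (X : ℕ → Ω → EuclideanSpace ℝ (Fin m))
    (Z : ℕ → ℕ → Ω → EuclideanSpace ℝ (Fin m)) : Prop where
  martingale : ∀ n, Martingale (Z n) ℱ μ
  memLp : ∀ n k, MemLp (Z n k) 2 μ
  zero : ∀ n, Z n 0 = 0
  indep_increment : ∀ n k, IndepOf μ (Z n (k + 1) - Z n k) (ℱ k)
  iIndep_increments : ∀ n, iIndepFun (fun k => Z n (k + 1) - Z n k) μ
  hasL2Sum : ∀ k, HasL2Sum μ (fun n => Z n k) (X k)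
  norm_sq : ∀ k, HasSum (fun n => l2norm μ (Z n k) ^ 2) (l2norm μ (X k) ^ 2)

/-! Fix a time k, put A = ℱ_{k-1}, G = ℱ_k, and let D be the set of centred square integrable
G-measurable variables independent of A. D is closed under scaling, though in general not under
sums, so one subtracts from the increment, step by step, a suitably scaled element of D that is
nearly best correlated with the current residual. Pythagoras gives the norm identity, and
`exists_tendsto_residual_of_weakGreedy` shows that the residuals converge in L² to some y orthogonal
to D.

The limit vanishes because D is rich. y is G-measurable with 𝔼[y | A] = 0, and testing against (1_B
- ℙ(B)) e_i shows that y_i integrates to 0 over every B ∈ G independent of A. For C = {y_i > 0} and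
0 < p < 1, the innovation yields such a B with ℙ(B) = p that lies in C where ℙ(C | A) > p and
contains C elsewhere (`exists_measurableSet_indep_comparable`). Comparing integrals forces ℙ(C) ≤ p
for every p (`ae_eq_zero_of_setIntegral_indep_eq_zero`), hence y = 0.

Summation over time rests on the orthogonality of martingale increments. X - ∑_{n<N} Z^n is a
martingale, so its squared norm is the sum over times of the squared residuals of the increments.
These are dominated by the squared norms of the increments of X, which are summable, and dominated
convergence handles N → ∞ at infinite time (`hasL2Sum_terminalValue`). -/

/-! ### The probability integral transform. -/

/-- If `ρ` has no atoms, its distribution function transforms it to the uniform distribution. -/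
theorem measure_setOf_measure_Iic_le {ρ : Measure ℝ} [IsProbabilityMeasure ρ]
    (hρ : ∀ t, ρ {t} = 0) {p : ℝ≥0} (hp0 : 0 < p) (hp1 : p < 1) :
    ρ {v | ρ (Set.Iic v) ≤ p} = p := by
  have : NullSingletonClass ρ := ⟨hρ⟩
  have hle : ∀ v, ρ (Set.Iic v) ≤ p ↔ cdf ρ v ≤ p := by
    intro v
    rw [← ofReal_cdf, ENNReal.ofReal_le_iff_le_toReal ENNReal.coe_ne_top, ENNReal.coe_toReal]
  have hcont : Continuous (cdf ρ) := by
    rw [continuous_iff_continuousAt]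
    intro x
    refine (monotone_cdf ρ).continuousAt_iff_leftLim_eq_rightLim.2 ?_
    have h1 : (cdf ρ).measure {x} = 0 := by rw [measure_cdf]; exact hρ x
    rw [StieltjesFunction.measure_singleton, ENNReal.ofReal_eq_zero] at h1
    rw [StieltjesFunction.rightLim_eq]
    exact le_antisymm ((monotone_cdf ρ).leftLim_le le_rfl) (by linarith)
  obtain ⟨a, ha⟩ := ((tendsto_cdf_atBot ρ).eventually (gt_mem_nhds (show (0 : ℝ) < p by simpa))).exists
  obtain ⟨b, hb⟩ := ((tendsto_cdf_atTop ρ).eventually (lt_mem_nhds (show (p : ℝ) < 1 by simpa))).exists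
  set E := {v | cdf ρ v ≤ p} with hE
  have hEclosed : IsClosed E := isClosed_le hcont continuous_const
  have hne : E.Nonempty := ⟨a, ha.le⟩
  have hbdd : BddAbove E := by
    refine ⟨b, fun v hv => ?_⟩
    by_contra! h
    exact absurd (monotone_cdf ρ h.le) (not_le.2 (lt_of_le_of_lt hv hb))
  set t := sSup E with ht
  have htE : t ∈ E := hEclosed.csSup_mem hne hbdd
  have hEeq : E = Set.Iic t := by
    ext v
    exact ⟨fun hv => le_csSup hbdd hv, fun hv => (monotone_cdf ρ hv).trans htE⟩
  -- To the right of the supremum the distribution function exceeds p, so by continuity it is at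
  -- least p at `t`.
  have htp : cdf ρ t = p := by
    refine le_antisymm htE ?_
    have : Tendsto (cdf ρ) (𝓝[>] t) (𝓝 (cdf ρ t)) := hcont.continuousWithinAt
    refine ge_of_tendsto this ?_
    filter_upwards [self_mem_nhdsWithin] with v hv
    by_contra! h
    exact absurd (le_csSup hbdd (show v ∈ E from h.le)) (not_le.2 hv)
  simp_rw [hle]
  rw [← hE, hEeq, ← ofReal_cdf, htp, ENNReal.ofReal_coe_nnreal]

/-! ### The conditional probability integral transform. -/

section Quantile

variable {Ω β : Type*} {mΩ : MeasurableSpace Ω} {mβ : MeasurableSpace β} {μ : Measure Ω}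
  [IsProbabilityMeasure μ] {X : Ω → β} {V : Ω → ℝ}

/-- The hypothesis bounds the conditional probability of each interval by c times its length, almost
surely. Restricting to rational endpoints makes this hold for all of them off one null set, and
every point lies in arbitrarily short such intervals. -/
theorem ae_condDistrib_singleton_eq_zero (hX : Measurable X) (hV : Measurable V) {c : ℝ≥0}
    (hc : ∀ a b : ℝ, ∀ S, MeasurableSet S →
      μ (X ⁻¹' S ∩ V ⁻¹' Set.Ioo a b) ≤ c * ENNReal.ofReal (b - a) * μ (X ⁻¹' S)) :
    ∀ᵐ x ∂(μ.map X), ∀ t, condDistrib V X μ x {t} = 0 := by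
  have : IsProbabilityMeasure (μ.map X) := Measure.isProbabilityMeasure_map hX.aemeasurable
  have h : ∀ a b : ℚ, ∀ᵐ x ∂(μ.map X),
      condDistrib V X μ x (Set.Ioo (a : ℝ) b) ≤ c * ENNReal.ofReal (b - a) := by
    intro a b
    refine ae_le_of_forall_setLIntegral_le_of_sigmaFinite
      (Kernel.measurable_coe _ measurableSet_Ioo) (fun S hS _ => ?_)
    have h1 := congrArg (fun ν : Measure (β × ℝ) => ν (S ×ˢ Set.Ioo (a : ℝ) b))
      (compProd_map_condDistrib (mβ := mβ) (X := X) (μ := μ) hV.aemeasurable)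
    simp only [Measure.compProd_apply_prod hS measurableSet_Ioo] at h1
    rw [h1, Measure.map_apply (hX.prodMk hV) (hS.prod measurableSet_Ioo),
      setLIntegral_const, Measure.map_apply hX hS]
    exact hc a b S hS
  filter_upwards [ae_all_iff.2 fun a => ae_all_iff.2 (h a)] with x hx t
  refine le_antisymm (le_of_forall_pos_le_add ?_) zero_le
  intro ε hε
  rw [zero_add]
  have hlim : Tendsto (fun n : ℕ => (c : ℝ≥0∞) * ENNReal.ofReal (2 / ((n : ℝ) + 1))) atTop (𝓝 0) := by
    have h2 : Tendsto (fun n : ℕ => 2 / ((n : ℝ) + 1)) atTop (𝓝 0) := by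
      simpa [div_eq_mul_inv] using (tendsto_one_div_add_atTop_nhds_zero_nat (𝕜 := ℝ)).const_mul 2
    have := ENNReal.Tendsto.const_mul (a := (c : ℝ≥0∞)) (ENNReal.tendsto_ofReal h2)
      (Or.inr ENNReal.coe_ne_top)
    simpa using this
  obtain ⟨n, hn⟩ := (hlim.eventually (gt_mem_nhds hε)).exists
  have hpos : (0 : ℝ) < 1 / ((n : ℝ) + 1) := by positivity
  obtain ⟨a, ha1, ha2⟩ := exists_rat_btwn (show t - 1 / ((n : ℝ) + 1) < t by linarith)
  obtain ⟨b, hb1, hb2⟩ := exists_rat_btwn (show t < t + 1 / ((n : ℝ) + 1) by linarith)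
  calc condDistrib V X μ x {t} ≤ condDistrib V X μ x (Set.Ioo (a : ℝ) b) :=
        measure_mono (by simpa using ⟨ha2, hb1⟩)
    _ ≤ c * ENNReal.ofReal (b - a) := hx a b
    _ ≤ c * ENNReal.ofReal (2 / ((n : ℝ) + 1)) := by
        gcongr
        have : (2 : ℝ) / ((n : ℝ) + 1) = 2 * (1 / ((n : ℝ) + 1)) := by ring
        rw [this]; linarith
    _ ≤ ε := hn.le

theorem measurable_condDistrib_Iic :
    Measurable fun z : β × ℝ => condDistrib V X μ z.1 (Set.Iic z.2) := by
  have hs : MeasurableSet {w : (β × ℝ) × ℝ | w.2 ≤ w.1.2} :=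
    measurableSet_le measurable_snd measurable_fst.snd
  have h := Kernel.measurable_kernel_prodMk_left
    (κ := (condDistrib V X μ).comap Prod.fst measurable_fst) hs
  exact h

/-- Disintegrate over X: almost every conditional law of V is atomless, so
`measure_setOf_measure_Iic_le` applies to it, and integration over S gives the claim. -/
theorem measure_inter_condDistrib_Iic_le (hX : Measurable X) (hV : Measurable V)
    (hat : ∀ᵐ x ∂(μ.map X), ∀ t, condDistrib V X μ x {t} = 0) {p : ℝ≥0} (hp0 : 0 < p)
    (hp1 : p < 1) {S : Set β} (hS : MeasurableSet S) :
    μ (X ⁻¹' S ∩ {ω | condDistrib V X μ (X ω) (Set.Iic (V ω)) ≤ p}) = p * μ (X ⁻¹' S) := by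
  have hE : MeasurableSet {z : β × ℝ | z.1 ∈ S ∧ condDistrib V X μ z.1 (Set.Iic z.2) ≤ p} :=
    (measurable_fst hS).inter (measurableSet_le measurable_condDistrib_Iic measurable_const)
  have h1 := congrArg (fun ν : Measure (β × ℝ) => ν {z : β × ℝ | z.1 ∈ S ∧ condDistrib V X μ z.1 (Set.Iic z.2) ≤ p})
    (compProd_map_condDistrib (mβ := mβ) (X := X) (μ := μ) hV.aemeasurable)
  simp only [Measure.compProd_apply hE, Measure.map_apply (hX.prodMk hV) hE] at h1
  refine Eq.trans h1.symm ?_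
  rw [← Measure.map_apply hX hS, ← lintegral_indicator_const hS]
  refine lintegral_congr_ae ?_
  filter_upwards [hat] with x hx
  by_cases hxS : x ∈ S
  · simp only [Set.preimage_ofPred_eq, hxS, true_and, Set.indicator_of_mem]
    exact measure_setOf_measure_Iic_le hx hp0 hp1
  · simp [hxS]

end Quantile

/-! ### Enough events independent of A. -/

/-- Given an innovation `U` over `A`, every event `C` can be compared with an event `B` of
conditional probability `p` given `A`: on `S ∈ A` one has `B ⊆ C`, and off `S` one has `C ⊆ B`. -/
theorem exists_measurableSet_indep_comparable {Ω : Type*} {A G mΩ : MeasurableSpace Ω}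
    {μ : Measure Ω} [IsProbabilityMeasure μ] (hAG : A ≤ G) (hG : G ≤ mΩ) {U : Ω → ℝ}
    (hU : Measurable[G] U) (hUlaw : μ.map U = volume.restrict (Set.Icc (0 : ℝ) 1))
    (hUA : IndepOf μ U A) {C : Set Ω} (hC : MeasurableSet[G] C) {p : ℝ≥0} (hp0 : 0 < p)
    (hp1 : p < 1) :
    ∃ B S : Set Ω, MeasurableSet[G] B ∧ MeasurableSet[A] S ∧
      (∀ T, MeasurableSet[A] T → μ (B ∩ T) = p * μ T) ∧
      (∀ᵐ ω ∂μ, ω ∈ B ∩ S → ω ∈ C) ∧ (∀ᵐ ω ∂μ, ω ∈ C \ S → ω ∈ B) := by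
  classical
  have hA : A ≤ mΩ := hAG.trans hG
  have hU' : Measurable U := hU.mono hG le_rfl
  -- V lies in [0,1] on C and in [2,3] off C, so its conditional quantiles exhaust C first; 3/2
  -- separates the two ranges.
  set V : Ω → ℝ := C.piecewise U (fun ω => U ω + 2) with hV_def
  have hVG : Measurable[G] V := Measurable.piecewise hC hU (hU.add_const 2)
  have hV : Measurable V := hVG.mono hG le_rfl
  -- The identity into (Ω, A) serves as the conditioning variable, so that `condDistrib` is the
  -- conditional law given A.
  have hX : @Measurable Ω Ω mΩ A id := measurable_id'' hA
  have hUT : ∀ (I : Set ℝ) (T : Set Ω), MeasurableSet I → MeasurableSet[A] T →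
      μ (T ∩ U ⁻¹' I) ≤ volume I * μ T := by
    intro I T hI hT
    have h1 := (Indep_iff _ _ μ).1 hUA (U ⁻¹' I) T ⟨I, hI, rfl⟩ hT
    rw [Set.inter_comm, h1, ← Measure.map_apply hU' hI, hUlaw]
    gcongr
    exact Measure.restrict_le_self
  -- The constant 2 arises because V ∈ (a, b) forces U into (a, b) or into (a - 2, b - 2).
  have hc : ∀ a b : ℝ, ∀ T, MeasurableSet[A] T →
      μ (id ⁻¹' T ∩ V ⁻¹' Set.Ioo a b) ≤ (2 : ℝ≥0) * ENNReal.ofReal (b - a) * μ (id ⁻¹' T) := by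
    intro a b T hT
    have hsub : id ⁻¹' T ∩ V ⁻¹' Set.Ioo a b ⊆
        (T ∩ U ⁻¹' Set.Ioo a b) ∪ (T ∩ U ⁻¹' Set.Ioo (a - 2) (b - 2)) := by
      rintro ω ⟨h1, h2⟩
      by_cases hω : ω ∈ C
      · left
        simp only [hV_def, Set.mem_preimage, Set.piecewise_eq_of_mem _ _ _ hω] at h2
        exact ⟨h1, h2⟩
      · right
        simp only [hV_def, Set.mem_preimage, Set.piecewise_eq_of_notMem _ _ _ hω, Set.mem_Ioo] at h2
        exact ⟨h1, by constructor <;> linarith [h2.1, h2.2]⟩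
    refine (measure_mono hsub).trans ((measure_union_le _ _).trans ?_)
    refine (add_le_add (hUT _ T measurableSet_Ioo hT) (hUT _ T measurableSet_Ioo hT)).trans ?_
    rw [Real.volume_Ioo, Real.volume_Ioo, sub_sub_sub_cancel_right, ← two_mul, mul_assoc]
    rfl
  have hat := @ae_condDistrib_singleton_eq_zero Ω Ω mΩ A μ _ id V hX hV 2 hc
  set κ := @condDistrib Ω Ω ℝ _ _ _ mΩ A V id μ _ with hκ
  have hκm : Measurable[A.prod inferInstance] fun z : Ω × ℝ => κ z.1 (Set.Iic z.2) :=
    @measurable_condDistrib_Iic Ω Ω mΩ A μ _ id V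
  have hUae : ∀ᵐ ω ∂μ, U ω ∈ Set.Icc (0 : ℝ) 1 := by
    have : ∀ᵐ u ∂(μ.map U), u ∈ Set.Icc (0 : ℝ) 1 := by
      rw [hUlaw]; exact ae_restrict_mem measurableSet_Icc
    exact ae_of_ae_map hU'.aemeasurable this
  -- B collects the lowest conditional p-fraction of V. Since V ≤ 3/2 means C almost surely, S is
  -- the event ℙ(C | A) > p.
  refine ⟨{ω | κ ω (Set.Iic (V ω)) ≤ p}, {ω | (p : ℝ≥0∞) < κ ω (Set.Iic (3 / 2))}, ?_, ?_, ?_, ?_, ?_⟩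
  · have h1 : @Measurable Ω (Ω × ℝ) G (A.prod inferInstance) fun ω => (ω, V ω) :=
      (measurable_id'' hAG).prodMk hVG
    exact hκm.comp h1 measurableSet_Iic
  · have h1 : Measurable[A] fun ω => κ ω (Set.Iic (3 / 2)) :=
      @Kernel.measurable_coe Ω ℝ A _ κ _ measurableSet_Iic
    exact h1 measurableSet_Ioi
  · intro T hT
    rw [Set.inter_comm]
    exact @measure_inter_condDistrib_Iic_le Ω Ω mΩ A μ _ id V hX hV hat p hp0 hp1 T hT
  · filter_upwards [hUae] with ω hω h
    by_contra hC'
    have h2 : (p : ℝ≥0∞) < κ ω (Set.Iic (3 / 2)) := h.2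
    refine absurd h2 (not_lt.2 (le_trans ?_ h.1))
    refine measure_mono (Set.Iic_subset_Iic.2 ?_)
    simp only [hV_def, Set.piecewise_eq_of_notMem _ _ _ hC']
    linarith [hω.1]
  · filter_upwards [hUae] with ω hω h
    have h2 : κ ω (Set.Iic (3 / 2)) ≤ p := not_lt.1 h.2
    refine le_trans (measure_mono (Set.Iic_subset_Iic.2 ?_)) h2
    simp only [hV_def, Set.piecewise_eq_of_mem _ _ _ h.1]
    linarith [hω.2]

/-- It suffices that {f > 0} is null, since f has mean 0. The comparable events B show that its
measure is at most p for every p in (0,1). -/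
theorem ae_eq_zero_of_setIntegral_indep_eq_zero {Ω : Type*} {A G mΩ : MeasurableSpace Ω}
    {μ : Measure Ω} [IsProbabilityMeasure μ] (hAG : A ≤ G) (hG : G ≤ mΩ) {U : Ω → ℝ}
    (hU : Measurable[G] U) (hUlaw : μ.map U = volume.restrict (Set.Icc (0 : ℝ) 1))
    (hUA : IndepOf μ U A) {f : Ω → ℝ} (hf : Integrable f μ) (hfG : Measurable[G] f)
    (hfA : ∀ T, MeasurableSet[A] T → ∫ ω in T, f ω ∂μ = 0)
    (hfB : ∀ B, MeasurableSet[G] B → (∃ p : ℝ≥0, ∀ T, MeasurableSet[A] T → μ (B ∩ T) = p * μ T) →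
      ∫ ω in B, f ω ∂μ = 0) :
    f =ᵐ[μ] 0 := by
  have hA : A ≤ mΩ := hAG.trans hG
  set C : Set Ω := {ω | 0 < f ω} with hC_def
  have hC : MeasurableSet[G] C := hfG measurableSet_Ioi
  have key : ∀ p : ℝ≥0, 0 < p → p < 1 → μ C ≤ p := by
    intro p hp0 hp1
    obtain ⟨B, S, hB, hS, hBT, hBS, hCS⟩ :=
      exists_measurableSet_indep_comparable hAG hG hU hUlaw hUA hC hp0 hp1
    have hB' := hG _ hB
    have hS' := hA _ hS
    have h1 : ∫ ω in B ∩ S, f ω ∂μ + ∫ ω in B \ S, f ω ∂μ = 0 := by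
      rw [integral_inter_add_sdiff hS' hf.integrableOn]
      exact hfB B hB ⟨p, hBT⟩
    have h2 : ∫ ω in Sᶜ ∩ B, f ω ∂μ + ∫ ω in Sᶜ \ B, f ω ∂μ = 0 := by
      rw [integral_inter_add_sdiff hB' hf.integrableOn]
      exact hfA _ hS.compl
    have h3 : ∫ ω in Sᶜ \ B, f ω ∂μ ≤ 0 := by
      refine setIntegral_nonpos_of_ae_restrict ?_
      filter_upwards [ae_restrict_of_ae hCS, ae_restrict_mem (hS'.compl.diff hB')] with ω hω h
      by_contra h'
      exact h.2 (hω ⟨not_le.1 h', h.1⟩)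
    have hpos : ∀ᵐ ω ∂μ.restrict (B ∩ S), 0 < f ω := by
      filter_upwards [ae_restrict_of_ae hBS, ae_restrict_mem (hB'.inter hS')] with ω hω h
      exact hω h
    have h4 : 0 ≤ ∫ ω in B ∩ S, f ω ∂μ :=
      setIntegral_nonneg_of_ae_restrict (hpos.mono fun _ h => h.le)
    -- As f integrates to 0 over B and over Sᶜ, its integral over B ∩ S equals that over Sᶜ \ B,
    -- which misses C and so contributes at most 0.
    have h5 : ∫ ω in B ∩ S, f ω ∂μ = 0 := by
      have : B \ S = Sᶜ ∩ B := by rw [Set.inter_comm]; rfl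
      rw [this] at h1
      linarith
    have h6 : μ (B ∩ S) = 0 := by
      rw [setIntegral_eq_zero_iff_of_nonneg_ae (hpos.mono fun _ h => h.le) hf.integrableOn] at h5
      have h7 : ∀ᵐ ω ∂μ.restrict (B ∩ S), False := by
        filter_upwards [hpos, h5] with ω h h'
        exact absurd h' h.ne'
      rw [← Measure.restrict_eq_zero]
      simpa using h7
    have h7 : μ S = 0 := by
      rw [hBT S hS] at h6
      simpa [hp0.ne'] using h6
    calc μ C ≤ μ (C \ S ∪ S) := measure_mono (by rw [Set.sdiff_union_self]; exact Set.subset_union_left)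
      _ ≤ μ (C \ S) + μ S := measure_union_le _ _
      _ = μ (C \ S) := by rw [h7, add_zero]
      _ ≤ μ B := measure_mono_ae hCS
      _ = p := by simpa using hBT Set.univ MeasurableSet.univ
  have hC0 : μ C = 0 := by
    refine le_antisymm (ENNReal.le_of_forall_pos_le_add fun ε hε _ => ?_) zero_le
    rw [zero_add]
    refine (key (min ε (1 / 2)) (lt_min hε (by norm_num))
      ((min_le_right _ _).trans_lt (by norm_num))).trans ?_
    exact_mod_cast min_le_left _ _
  have hfle : ∀ᵐ ω ∂μ, f ω ≤ 0 := by
    rw [ae_iff]; simpa [hC_def] using hC0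
  have hint : ∫ ω, f ω ∂μ = 0 := by
    simpa using hfA Set.univ MeasurableSet.univ
  have h := (integral_eq_zero_iff_of_nonneg_ae (f := fun ω => - f ω) (μ := μ)
    (hfle.mono fun ω h => by simpa using h) hf.neg).1 (by rw [integral_neg, hint, neg_zero])
  filter_upwards [h] with ω h
  simpa using h

/-! ### Weak greedy algorithms in a Hilbert space. -/

section Greedy

open scoped RealInnerProductSpace

/-- Otherwise Cauchy–Schwarz on the partial sums gives a_n² ≥ const / (n + 1) for all n ≥ N, and the
harmonic series diverges. -/
theorem Summable.exists_mul_sum_range_le {a : ℕ → ℝ}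
    (hs : Summable fun n => a n ^ 2) {ε : ℝ} (hε : 0 < ε) (N : ℕ) :
    ∃ n, N ≤ n ∧ a n * ∑ i ∈ Finset.range n, a i ≤ ε := by
  by_contra! h
  set M := ∑' n, a n ^ 2 + 1 with hM
  have hM0 : 0 < M := by
    have : 0 ≤ ∑' n, a n ^ 2 := tsum_nonneg fun n => sq_nonneg (a n)
    linarith
  have key : ∀ n, N ≤ n → ε ^ 2 / M * (1 / ((n : ℝ) + 1)) ≤ a n ^ 2 := by
    intro n hn
    have h1 : (∑ i ∈ Finset.range n, a i) ^ 2 ≤ n * ∑ i ∈ Finset.range n, a i ^ 2 := by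
      simpa using sq_sum_le_card_mul_sum_sq (s := Finset.range n) (f := a)
    have h2 : ∑ i ∈ Finset.range n, a i ^ 2 ≤ M := by
      have := hs.sum_le_tsum (Finset.range n) fun i _ => sq_nonneg (a i)
      linarith
    have h3 : (∑ i ∈ Finset.range n, a i) ^ 2 ≤ ((n : ℝ) + 1) * M := by
      refine h1.trans (mul_le_mul (by linarith) h2 (Finset.sum_nonneg fun i _ => sq_nonneg _)
        (by positivity))
    have h4 : ε ^ 2 ≤ a n ^ 2 * (∑ i ∈ Finset.range n, a i) ^ 2 := by
      rw [← mul_pow]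
      exact pow_le_pow_left₀ hε.le (h n hn).le 2
    have h5 : ε ^ 2 ≤ a n ^ 2 * (((n : ℝ) + 1) * M) :=
      h4.trans (mul_le_mul_of_nonneg_left h3 (sq_nonneg _))
    rw [div_mul_div_comm, mul_one, div_le_iff₀ (by positivity)]
    linarith
  have h1 : Summable fun n : ℕ => ε ^ 2 / M * (1 / (((n + N : ℕ) : ℝ) + 1)) := by
    refine Summable.of_nonneg_of_le (fun n => by positivity) (fun n => key (n + N) (by omega)) ?_
    exact (summable_nat_add_iff (f := fun n => a n ^ 2) N).2 hs
  rw [summable_mul_left_iff (by positivity)] at h1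
  have h2 : Summable fun n : ℕ => 1 / (((n + (N + 1) : ℕ)) : ℝ) := by
    refine h1.congr fun n => ?_
    push_cast
    ring
  exact Real.not_summable_one_div_natCast
    ((summable_nat_add_iff (f := fun n : ℕ => 1 / (n : ℝ)) (N + 1)).1 h2)

variable {H : Type*} [NormedAddCommGroup H] [InnerProductSpace ℝ H]

theorem norm_sq_eq_norm_sq_sub_sum_add {x : H} {η : ℕ → H}
    (hη : ∀ n, ⟪x - ∑ i ∈ Finset.range n, η i, η n⟫ = ‖η n‖ ^ 2) (n : ℕ) :
    ‖x‖ ^ 2 = ‖x - ∑ i ∈ Finset.range n, η i‖ ^ 2 + ∑ i ∈ Finset.range n, ‖η i‖ ^ 2 := by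
  induction n with
  | zero => simp
  | succ n ih =>
    rw [ih, Finset.sum_range_succ, Finset.sum_range_succ, ← sub_sub,
      norm_sub_sq_real (x - ∑ i ∈ Finset.range n, η i), hη n]
    ring

/-- Convergence of the weak greedy algorithm with respect to a dictionary `D` in a Hilbert space:
the residuals converge to a vector orthogonal to `D`. -/
theorem exists_tendsto_residual_of_weakGreedy [CompleteSpace H] {x : H} {η : ℕ → H} {D : Set H}
    {c : ℝ} (hηD : ∀ n, η n ∈ D)
    (hη : ∀ n, ⟪x - ∑ i ∈ Finset.range n, η i, η n⟫ = ‖η n‖ ^ 2)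
    (hD : ∀ n, ∀ g ∈ D, |⟪x - ∑ i ∈ Finset.range n, η i, g⟫| ≤ c * ‖η n‖ * ‖g‖) :
    ∃ y, Tendsto (fun n => x - ∑ i ∈ Finset.range n, η i) atTop (𝓝 y) ∧ ∀ g ∈ D, ⟪y, g⟫ = 0 := by
  set r : ℕ → H := fun n => x - ∑ i ∈ Finset.range n, η i with hr
  have hnorm := norm_sq_eq_norm_sq_sub_sum_add hη
  have hsum : Summable fun n => ‖η n‖ ^ 2 := by
    refine summable_of_sum_range_le (c := ‖x‖ ^ 2) (fun n => sq_nonneg _) fun n => ?_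
    rw [hnorm n]
    exact le_add_of_nonneg_left (sq_nonneg _)
  have hη0 : Tendsto (fun n => ‖η n‖) atTop (𝓝 0) := by
    have := hsum.tendsto_atTop_zero.sqrt
    simpa using this
  have hdiff : ∀ m n, m ≤ n → r m = r n + ∑ i ∈ Finset.Ico m n, η i := by
    intro m n hmn
    simp only [hr]
    rw [Finset.sum_Ico_eq_sub _ hmn]
    abel
  have hrsq : ∀ n, ‖r n‖ ^ 2 = ‖x‖ ^ 2 - ∑ i ∈ Finset.range n, ‖η i‖ ^ 2 := fun n => by
    rw [hnorm n]; simp [hr]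
  have hlim : Tendsto (fun n => ‖r n‖ ^ 2) atTop (𝓝 (‖x‖ ^ 2 - ∑' i, ‖η i‖ ^ 2)) := by
    simp_rw [hrsq]
    exact tendsto_const_nhds.sub hsum.hasSum.tendsto_sum_nat
  have hLle : ∀ n, ‖x‖ ^ 2 - ∑' i, ‖η i‖ ^ 2 ≤ ‖r n‖ ^ 2 := fun n => by
    rw [hrsq]
    have := hsum.sum_le_tsum (Finset.range n) fun i _ => sq_nonneg ‖η i‖
    linarith
  -- Expand the square: r_m - r_n is a sum of dictionary elements, and each of them has inner
  -- product with r_n controlled by ‖η_n‖.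
  have hbound : ∀ m n, m ≤ n → ‖r m - r n‖ ^ 2 ≤
      ‖r m‖ ^ 2 - ‖r n‖ ^ 2 + 2 * |c| * (‖η n‖ * ∑ i ∈ Finset.range n, ‖η i‖) := by
    intro m n hmn
    have h1 : ⟪r m, r n⟫ = ‖r n‖ ^ 2 + ∑ i ∈ Finset.Ico m n, ⟪r n, η i⟫ := by
      rw [hdiff m n hmn, inner_add_left, real_inner_self_eq_norm_sq, sum_inner]
      simp_rw [real_inner_comm]
    have h2 : -(∑ i ∈ Finset.Ico m n, ⟪r n, η i⟫) ≤
        |c| * (‖η n‖ * ∑ i ∈ Finset.range n, ‖η i‖) := by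
      calc -(∑ i ∈ Finset.Ico m n, ⟪r n, η i⟫) ≤ |∑ i ∈ Finset.Ico m n, ⟪r n, η i⟫| := neg_le_abs _
        _ ≤ ∑ i ∈ Finset.Ico m n, |⟪r n, η i⟫| := Finset.abs_sum_le_sum_abs _ _
        _ ≤ ∑ i ∈ Finset.Ico m n, |c| * ‖η n‖ * ‖η i‖ := by
          refine Finset.sum_le_sum fun i _ => (hD n _ (hηD i)).trans ?_
          gcongr
          exact le_abs_self c
        _ ≤ ∑ i ∈ Finset.range n, |c| * ‖η n‖ * ‖η i‖ := by
          refine Finset.sum_le_sum_of_subset_of_nonneg ?_ fun i _ _ => by positivity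
          rw [Finset.range_eq_Ico]
          exact Finset.Ico_subset_Ico_left (Nat.zero_le _)
        _ = |c| * (‖η n‖ * ∑ i ∈ Finset.range n, ‖η i‖) := by
          rw [← Finset.mul_sum, mul_assoc]
    rw [norm_sub_sq_real, h1]
    linarith
  have hcauchy : CauchySeq r := by
    rw [Metric.cauchySeq_iff]
    intro ε hε
    -- Two errors of size δ have to fit below (ε/2)², and 2/9 < 1/4.
    set δ := ε ^ 2 / 9 with hδ
    have hδ0 : 0 < δ := by positivity
    obtain ⟨N, hN⟩ := eventually_atTop.1
      (hlim.eventually (gt_mem_nhds (lt_add_of_pos_right (‖x‖ ^ 2 - ∑' i, ‖η i‖ ^ 2) hδ0)))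
    refine ⟨N, fun m hm m' hm' => ?_⟩
    -- Both residuals are compared with a common later one, at an index where the error term of
    -- `hbound` is small; the + 1 keeps the divisor positive if c = 0.
    obtain ⟨n, hn, hprod⟩ := hsum.exists_mul_sum_range_le
      (show 0 < δ / (2 * |c| + 1) by positivity) (max m m')
    have hprod' : 2 * |c| * (‖η n‖ * ∑ i ∈ Finset.range n, ‖η i‖) ≤ δ := by
      rw [le_div_iff₀ (by positivity)] at hprod
      have : 0 ≤ ‖η n‖ * ∑ i ∈ Finset.range n, ‖η i‖ :=
        mul_nonneg (norm_nonneg _) (Finset.sum_nonneg fun i _ => norm_nonneg _)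
      linarith
    have hclose : ∀ k, N ≤ k → k ≤ n → ‖r k - r n‖ < ε / 2 := by
      intro k hk hkn
      refine lt_of_pow_lt_pow_left₀ 2 (by positivity) ?_
      have h1 := hbound k n hkn
      have h2 := hN k hk
      have h3 := hLle n
      have h4 : 2 * δ < (ε / 2) ^ 2 := by
        rw [hδ]
        nlinarith [sq_pos_of_pos hε]
      linarith
    rw [dist_eq_norm]
    calc ‖r m - r m'‖ = ‖(r m - r n) - (r m' - r n)‖ := by rw [sub_sub_sub_cancel_right]
      _ ≤ ‖r m - r n‖ + ‖r m' - r n‖ := norm_sub_le _ _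
      _ < ε / 2 + ε / 2 := add_lt_add (hclose m hm ((le_max_left _ _).trans hn))
          (hclose m' hm' ((le_max_right _ _).trans hn))
      _ = ε := add_halves ε
  obtain ⟨y, hy⟩ := cauchySeq_tendsto_of_complete hcauchy
  refine ⟨y, hy, fun g hg => ?_⟩
  have h1 : Tendsto (fun n => ⟪r n, g⟫) atTop (𝓝 ⟪y, g⟫) := hy.inner tendsto_const_nhds
  have h2 : Tendsto (fun n => ⟪r n, g⟫) atTop (𝓝 0) := by
    refine squeeze_zero_norm (fun n => hD n g hg) ?_
    simpa using (hη0.const_mul c).mul_const ‖g‖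
  exact tendsto_nhds_unique h1 h2

/-- Choose an element reaching at least half the supremum of the normalised correlations, and
rescale it to the projection of x onto its line. The factor 2 avoids any question of attainment. -/
theorem exists_weakGreedy_step {D : Set H} (h0 : (0 : H) ∈ D) (hsmul : ∀ t : ℝ, ∀ g ∈ D, t • g ∈ D)
    (x : H) : ∃ e ∈ D, ⟪x, e⟫ = ‖e‖ ^ 2 ∧ ∀ g ∈ D, |⟪x, g⟫| ≤ 2 * ‖e‖ * ‖g‖ := by
  set Q : Set ℝ := (fun g => |⟪x, g⟫| / ‖g‖) '' D with hQ
  have hbdd : BddAbove Q := by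
    refine ⟨‖x‖, ?_⟩
    rintro _ ⟨g, -, rfl⟩
    exact div_le_of_le_mul₀ (norm_nonneg _) (norm_nonneg _) (abs_real_inner_le_norm x g)
  have hle : ∀ g ∈ D, |⟪x, g⟫| ≤ sSup Q * ‖g‖ := by
    intro g hg
    rcases eq_or_ne g 0 with rfl | hg0
    · simp
    · rw [← div_le_iff₀ (norm_pos_iff.2 hg0)]
      exact le_csSup hbdd ⟨g, hg, rfl⟩
  rcases le_or_gt (sSup Q) 0 with hs | hs
  · refine ⟨0, h0, by simp, fun g hg => ?_⟩
    refine (hle g hg).trans ?_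
    simpa using mul_nonpos_of_nonpos_of_nonneg hs (norm_nonneg g)
  · obtain ⟨_, ⟨g₀, hg₀, rfl⟩, hlt⟩ := exists_lt_of_lt_csSup (s := Q) ⟨_, 0, h0, rfl⟩ (half_lt_self hs)
    have hne : g₀ ≠ 0 := by
      rintro rfl
      simp only [inner_zero_right, abs_zero, norm_zero, div_zero] at hlt
      linarith
    have hpos := norm_pos_iff.2 hne
    refine ⟨(⟪x, g₀⟫ / ‖g₀‖ ^ 2) • g₀, hsmul _ _ hg₀, ?_, fun g hg => (hle g hg).trans ?_⟩
    · rw [inner_smul_right, norm_smul, mul_pow, Real.norm_eq_abs, sq_abs]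
      field_simp
    · have : ‖(⟪x, g₀⟫ / ‖g₀‖ ^ 2) • g₀‖ = |⟪x, g₀⟫| / ‖g₀‖ := by
        rw [norm_smul, Real.norm_eq_abs, abs_div, abs_of_pos (pow_pos hpos 2)]
        field_simp
      rw [this]
      gcongr
      simp only at hlt
      linarith

theorem exists_weakGreedy {D : Set H} (h0 : (0 : H) ∈ D) (hsmul : ∀ t : ℝ, ∀ g ∈ D, t • g ∈ D)
    (x : H) : ∃ η : ℕ → H, ∀ n, η n ∈ D ∧
      ⟪x - ∑ i ∈ Finset.range n, η i, η n⟫ = ‖η n‖ ^ 2 ∧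
      ∀ g ∈ D, |⟪x - ∑ i ∈ Finset.range n, η i, g⟫| ≤ 2 * ‖η n‖ * ‖g‖ := by
  choose f hfD hf hfle using exists_weakGreedy_step h0 hsmul
  set r : ℕ → H := fun n => (fun z => z - f z)^[n] x with hr
  have hrsum : ∀ n, r n = x - ∑ i ∈ Finset.range n, f (r i) := by
    intro n
    induction n with
    | zero => simp [hr]
    | succ n ih =>
      rw [Finset.sum_range_succ, ← sub_sub, ← ih]
      simp only [hr, Function.iterate_succ_apply']
  refine ⟨fun n => f (r n), fun n => ⟨hfD _, ?_, ?_⟩⟩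
  · rw [← hrsum]; exact hf _
  · rw [← hrsum]; exact hfle _

/-- A best multiple of e is the projection of x onto the line of e; compare with t = ⟪x, e⟫ / ‖e‖².
-/
theorem inner_eq_norm_sq_of_forall_norm_sub_le {x e : H} (h : ∀ t : ℝ, ‖x - e‖ ≤ ‖x - t • e‖) :
    ⟪x, e⟫ = ‖e‖ ^ 2 := by
  rcases eq_or_ne e 0 with rfl | he
  · simp
  have hpos : 0 < ‖e‖ ^ 2 := pow_pos (norm_pos_iff.2 he) 2
  have h1 := pow_le_pow_left₀ (norm_nonneg _) (h (⟪x, e⟫ / ‖e‖ ^ 2)) 2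
  rw [norm_sub_sq_real, norm_sub_sq_real, inner_smul_right, norm_smul, mul_pow, Real.norm_eq_abs,
    sq_abs] at h1
  have h2 : (⟪x, e⟫ / ‖e‖ ^ 2) ^ 2 * ‖e‖ ^ 2 = ⟪x, e⟫ / ‖e‖ ^ 2 * ⟪x, e⟫ := by field_simp
  have h3 : (⟪x, e⟫ - ‖e‖ ^ 2) ^ 2 ≤ 0 := by
    have h4 : ⟪x, e⟫ / ‖e‖ ^ 2 * ⟪x, e⟫ * ‖e‖ ^ 2 = ⟪x, e⟫ ^ 2 := by field_simp
    nlinarith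
  nlinarith [pow_eq_zero_iff (two_ne_zero) |>.1 (le_antisymm h3 (sq_nonneg _))]

theorem abs_inner_le_of_forall_norm_sub_le {x e g : H} (he : ⟪x, e⟫ = ‖e‖ ^ 2)
    (h : ∀ t : ℝ, ‖x - e‖ ≤ ‖x - t • g‖) : |⟪x, g⟫| ≤ ‖e‖ * ‖g‖ := by
  rcases eq_or_ne g 0 with rfl | hg
  · simp
  have hpos : 0 < ‖g‖ ^ 2 := pow_pos (norm_pos_iff.2 hg) 2
  have h1 := pow_le_pow_left₀ (norm_nonneg _) (h (⟪x, g⟫ / ‖g‖ ^ 2)) 2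
  rw [norm_sub_sq_real, norm_sub_sq_real, he, inner_smul_right, norm_smul, mul_pow,
    Real.norm_eq_abs, sq_abs] at h1
  have h2 : (⟪x, g⟫ / ‖g‖ ^ 2) ^ 2 * ‖g‖ ^ 2 = ⟪x, g⟫ / ‖g‖ ^ 2 * ⟪x, g⟫ := by field_simp
  have h4 : ⟪x, g⟫ / ‖g‖ ^ 2 * ⟪x, g⟫ * ‖g‖ ^ 2 = ⟪x, g⟫ ^ 2 := by field_simp
  refine abs_le_of_sq_le_sq ?_ (by positivity)
  rw [mul_pow]
  nlinarith

end Greedy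

/-! ### The dictionary of independent centred variables and its totality. -/

section L2

open scoped RealInnerProductSpace

variable {Ω : Type*} {A G mΩ : MeasurableSpace Ω} {μ : Measure Ω} {m : ℕ}
  {ξ f g : Ω → EuclideanSpace ℝ (Fin m)} {η : ℕ → Ω → EuclideanSpace ℝ (Fin m)}

theorem l2norm_eq_norm_toLp (hf : MemLp f 2 μ) : l2norm μ f = ‖hf.toLp f‖ :=
  (Lp.norm_toLp f hf).symm

theorem memLp_sub_sum (hξ : MemLp ξ 2 μ) (hη : ∀ n, MemLp (η n) 2 μ) (s : Finset ℕ) :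
    MemLp (ξ - ∑ i ∈ s, η i) 2 μ :=
  hξ.sub (memLp_finsetSum' s fun i _ => hη i)

theorem toLp_sum (hη : ∀ n, MemLp (η n) 2 μ) (s : Finset ℕ) :
    (memLp_finsetSum' s fun i _ => hη i).toLp (∑ i ∈ s, η i) = ∑ i ∈ s, (hη i).toLp (η i) := by
  classical
  induction s using Finset.induction_on with
  | empty => simp only [Finset.sum_empty]; exact MemLp.toLp_zero _
  | insert a s ha ih =>
    simp only [Finset.sum_insert ha, ← ih, ← MemLp.toLp_add]

theorem toLp_sub_sum (hξ : MemLp ξ 2 μ) (hη : ∀ n, MemLp (η n) 2 μ) (s : Finset ℕ) :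
    (memLp_sub_sum hξ hη s).toLp (ξ - ∑ i ∈ s, η i) =
      hξ.toLp ξ - ∑ i ∈ s, (hη i).toLp (η i) := by
  rw [← toLp_sum hη, ← MemLp.toLp_sub]

theorem inner_toLp_eq_integral (hf : MemLp f 2 μ) (hg : MemLp g 2 μ) :
    ⟪hf.toLp f, hg.toLp g⟫ = ∫ ω, ⟪f ω, g ω⟫ ∂μ := by
  rw [L2.inner_def]
  refine integral_congr_ae ?_
  filter_upwards [hf.coeFn_toLp, hg.coeFn_toLp] with ω h1 h2
  rw [h1, h2]

theorem IndepOf.comp {β γ : Type*} [MeasurableSpace β] [MeasurableSpace γ] {f : Ω → β}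
    (hf : IndepOf μ f A) {φ : β → γ} (hφ : Measurable φ) : IndepOf μ (φ ∘ f) A := by
  refine indep_of_indep_of_le_left hf ?_
  rw [← MeasurableSpace.comap_comp]
  exact MeasurableSpace.comap_mono hφ.comap_le

theorem indepOf_of_measurable_generateFrom_singleton [IsProbabilityMeasure μ] (hA : A ≤ mΩ)
    {β : Type*} [MeasurableSpace β] {f : Ω → β} {B : Set Ω} (hB : MeasurableSet B)
    (hBA : ∀ T, MeasurableSet[A] T → μ (B ∩ T) = μ B * μ T)
    (hf : Measurable[MeasurableSpace.generateFrom {B}] f) : IndepOf μ f A := by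
  refine indep_of_indep_of_le_left ?_ hf.comap_le
  refine IndepSets.indep (p1 := {B}) (p2 := {T | MeasurableSet[A] T}) ?_ hA
    (IsPiSystem.singleton B) (@MeasurableSpace.isPiSystem_measurableSet Ω A) rfl
    (@MeasurableSpace.generateFrom_measurableSet Ω A).symm ?_
  · exact MeasurableSpace.generateFrom_le fun t ht => by rwa [Set.mem_singleton_iff.1 ht]
  · rw [IndepSets_iff]
    rintro _ T rfl hT
    exact hBA T hT

variable (A G μ m) in
/-- The classes of the square integrable centred `G`-measurable random variables that are
independent of `A`. -/
def indepCentered : Set (Lp (EuclideanSpace ℝ (Fin m)) 2 μ) :=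
  {g | ∃ ζ : Ω → EuclideanSpace ℝ (Fin m), StronglyMeasurable[G] ζ ∧ IndepOf μ ζ A ∧
    g =ᵐ[μ] ζ ∧ ∫ ω, ζ ω ∂μ = 0}

theorem smul_mem_indepCentered (t : ℝ) {g : Lp (EuclideanSpace ℝ (Fin m)) 2 μ}
    (hg : g ∈ indepCentered A G μ m) : t • g ∈ indepCentered A G μ m := by
  obtain ⟨ζ, h1, h2, h3, h4⟩ := hg
  refine ⟨t • ζ, h1.const_smul t, h2.comp (measurable_const_smul t), ?_, ?_⟩
  · filter_upwards [Lp.coeFn_smul t g, h3] with ω h5 h6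
    rw [h5, Pi.smul_apply, h6, Pi.smul_apply]
  · simp [integral_smul, h4]

theorem zero_mem_indepCentered [IsProbabilityMeasure μ] :
    (0 : Lp (EuclideanSpace ℝ (Fin m)) 2 μ) ∈ indepCentered A G μ m := by
  refine ⟨fun _ => 0, stronglyMeasurable_const, ?_, ?_, by simp⟩
  · unfold IndepOf
    rw [MeasurableSpace.comap_const]
    exact indep_bot_left A
  · exact Lp.coeFn_zero _ _ _

/-- The variables (1_B - p) e_i, with B independent of A and of probability p, belong to the
dictionary. They reduce the claim to `ae_eq_zero_of_setIntegral_indep_eq_zero` in each coordinate.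
-/
theorem eq_zero_of_forall_inner_indepCentered_eq_zero [IsProbabilityMeasure μ] (hAG : A ≤ G)
    (hG : G ≤ mΩ) {U : Ω → ℝ} (hU : Measurable[G] U)
    (hUlaw : μ.map U = volume.restrict (Set.Icc (0 : ℝ) 1)) (hUA : IndepOf μ U A)
    {y : Lp (EuclideanSpace ℝ (Fin m)) 2 μ} (hyG : AEStronglyMeasurable[G] y μ)
    (hyA : ∀ T, MeasurableSet[A] T → ∫ ω in T, y ω ∂μ = 0)
    (hy : ∀ g ∈ indepCentered A G μ m, ⟪y, g⟫ = 0) : y = 0 := by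
  obtain ⟨f, hfG, hyf⟩ := hyG
  have hA : A ≤ mΩ := hAG.trans hG
  have hint : Integrable f μ := ((Lp.memLp y).integrable (by norm_num)).congr hyf
  have hsetint : ∀ T, MeasurableSet[A] T → ∫ ω in T, f ω ∂μ = 0 := fun T hT => by
    rw [← hyA T hT]
    exact integral_congr_ae (ae_restrict_of_ae hyf.symm)
  have hcoord : ∀ (i : Fin m) (T : Set Ω), ∫ ω in T, f ω i ∂μ = (∫ ω in T, f ω ∂μ) i := by
    intro i T
    exact (EuclideanSpace.proj (𝕜 := ℝ) i).integral_comp_comm (φ := f) hint.integrableOn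
  have hzero : ∀ i, (fun ω => f ω i) =ᵐ[μ] 0 := by
    intro i
    have hinti : Integrable (fun ω => f ω i) μ :=
      (EuclideanSpace.proj (𝕜 := ℝ) i).integrable_comp hint
    refine ae_eq_zero_of_setIntegral_indep_eq_zero hAG hG hU hUlaw hUA hinti
      ((EuclideanSpace.proj (𝕜 := ℝ) i).continuous.measurable.comp hfG.measurable) ?_ ?_
    · intro T hT
      rw [hcoord, hsetint T hT]
      rfl
    · rintro B hB ⟨p, hp⟩
      have hB' := hG _ hB
      have hBp : μ B = p := by simpa using hp Set.univ MeasurableSet.univ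
      set φ : Ω → ℝ := fun ω => B.indicator (fun _ => (1 : ℝ)) ω - p with hφ
      have hφm : ∀ M : MeasurableSpace Ω, MeasurableSet[M] B → Measurable[M] φ := fun M hM =>
        ((measurable_const.indicator hM).sub_const _)
      set ζ : Ω → EuclideanSpace ℝ (Fin m) := fun ω => φ ω • EuclideanSpace.single i (1 : ℝ) with hζ
      have hζm : ∀ M : MeasurableSpace Ω, MeasurableSet[M] B → StronglyMeasurable[M] ζ :=
        fun M hM => (hφm M hM).stronglyMeasurable.smul_const _
      have hφint : ∫ ω, φ ω ∂μ = 0 := by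
        rw [integral_sub ((integrable_const _).indicator hB') (integrable_const _),
          integral_indicator_const _ hB', integral_const, measureReal_def, hBp]
        simp
      have hζL : MemLp ζ 2 μ := by
        refine MemLp.of_bound (hζm _ hB').aestronglyMeasurable (1 + p) (ae_of_all _ fun ω => ?_)
        rw [hζ, norm_smul, PiLp.norm_single, norm_one, mul_one, hφ]
        refine (norm_sub_le _ _).trans (add_le_add ?_ (by simp))
        by_cases h : ω ∈ B <;> simp [h]
      have hmem : hζL.toLp ζ ∈ indepCentered A G μ m := by
        refine ⟨ζ, hζm G hB, ?_, hζL.coeFn_toLp, ?_⟩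
        · refine indepOf_of_measurable_generateFrom_singleton hA hB' ?_
            (hζm _ (MeasurableSpace.measurableSet_generateFrom (Set.mem_singleton B))).measurable
          intro T hT
          rw [hp T hT, hBp]
        · rw [hζ, integral_smul_const, hφint, zero_smul]
      have h := hy _ hmem
      rw [L2.inner_def] at h
      have h2 : ∫ ω, (B.indicator (fun ω => f ω i) ω - p * f ω i) ∂μ = 0 := by
        rw [← h]
        refine integral_congr_ae ?_
        filter_upwards [hyf, hζL.coeFn_toLp] with ω h3 h4
        rw [h3, h4, hζ, inner_smul_right, EuclideanSpace.inner_single_right]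
        by_cases hω : ω ∈ B <;> simp [hφ, hω, sub_mul]
      rw [integral_sub (hinti.indicator hB') (hinti.const_mul _), integral_indicator hB',
        integral_const_mul] at h2
      have h5 : ∫ ω, f ω i ∂μ = 0 := by
        have := hcoord i Set.univ
        rw [hsetint _ MeasurableSet.univ] at this
        simpa using this
      rw [h5, mul_zero, sub_zero] at h2
      exact h2
  rw [Lp.eq_zero_iff_ae_eq_zero]
  filter_upwards [hyf, ae_all_iff.2 hzero] with ω h1 h2
  rw [h1]
  ext i
  exact h2 i

end L2

/-! ### Expansion of a single increment. -/

section Expansion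

open scoped RealInnerProductSpace

variable {Ω : Type*} {A G mΩ : MeasurableSpace Ω} {μ : Measure Ω} {m : ℕ}
  {ξ : Ω → EuclideanSpace ℝ (Fin m)} {η : ℕ → Ω → EuclideanSpace ℝ (Fin m)}

theorem norm_sub_toLp_le_of_isBestIndepApprox {η ζ : Ω → EuclideanSpace ℝ (Fin m)}
    (h : IsBestIndepApprox μ A G ξ η) (hξ : MemLp ξ 2 μ) (hη : MemLp η 2 μ) (hζ : MemLp ζ 2 μ)
    (hζG : StronglyMeasurable[G] ζ) (hζA : IndepOf μ ζ A) :
    ‖hξ.toLp ξ - hη.toLp η‖ ≤ ‖hξ.toLp ξ - hζ.toLp ζ‖ := by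
  rw [← MemLp.toLp_sub, ← MemLp.toLp_sub, Lp.norm_toLp, Lp.norm_toLp]
  exact ENNReal.toReal_mono (hξ.sub hζ).2.ne (h.le ζ hζG hζA)

theorem IsBestIndepApprox.inner_eq_norm_sq {η : Ω → EuclideanSpace ℝ (Fin m)}
    (h : IsBestIndepApprox μ A G ξ η) (hξ : MemLp ξ 2 μ) (hη : MemLp η 2 μ) :
    ⟪hξ.toLp ξ, hη.toLp η⟫ = ‖hη.toLp η‖ ^ 2 := by
  refine inner_eq_norm_sq_of_forall_norm_sub_le fun t => ?_
  rw [← MemLp.toLp_const_smul]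
  exact norm_sub_toLp_le_of_isBestIndepApprox h hξ hη _ (h.stronglyMeasurable.const_smul t)
    (h.indep.comp (measurable_const_smul t))

theorem IsBestIndepApprox.abs_inner_le {η : Ω → EuclideanSpace ℝ (Fin m)}
    (h : IsBestIndepApprox μ A G ξ η) (hξ : MemLp ξ 2 μ) (hη : MemLp η 2 μ)
    {g : Lp (EuclideanSpace ℝ (Fin m)) 2 μ} (hg : g ∈ indepCentered A G μ m) :
    |⟪hξ.toLp ξ, g⟫| ≤ ‖hη.toLp η‖ * ‖g‖ := by
  refine abs_inner_le_of_forall_norm_sub_le (h.inner_eq_norm_sq hξ hη) fun t => ?_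
  obtain ⟨ζ, h1, h2, h3, -⟩ := smul_mem_indepCentered t hg
  have hζ : MemLp ζ 2 μ := (memLp_congr_ae h3).1 (Lp.memLp (t • g))
  have heq : hζ.toLp ζ = t • g := by
    rw [← Lp.toLp_coeFn (t • g) (Lp.memLp (t • g))]
    exact MemLp.toLp_congr _ _ h3.symm
  rw [← heq]
  exact norm_sub_toLp_le_of_isBestIndepApprox h hξ hη hζ h1 h2

variable [IsProbabilityMeasure μ]

theorem condExp_eq_zero_of_indepOf (hA : A ≤ mΩ) {f : Ω → EuclideanSpace ℝ (Fin m)}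
    (hf : StronglyMeasurable f) (hind : IndepOf μ f A) (hmean : ∫ ω, f ω ∂μ = 0) :
    μ[f | A] =ᵐ[μ] 0 := by
  have h := condExp_indep_eq hf.measurable.comap_le hA
    ((Measurable.of_comap_le le_rfl).stronglyMeasurable) hind
  rw [hmean] at h
  exact h

theorem integral_eq_zero_of_condExp_eq_zero (hA : A ≤ mΩ) {f : Ω → EuclideanSpace ℝ (Fin m)}
    (hf : μ[f | A] =ᵐ[μ] 0) : ∫ ω, f ω ∂μ = 0 := by
  rw [← integral_condExp hA, integral_congr_ae hf]
  simp

/-- Common core of existence (c = 2) and of successive best approximation (c = 1): the limiting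
residual is orthogonal to a total dictionary. -/
theorem isIndepExpansion_of_weakGreedy (hAG : A ≤ G) (hG : G ≤ mΩ) {U : Ω → ℝ}
    (hU : Measurable[G] U) (hUlaw : μ.map U = volume.restrict (Set.Icc (0 : ℝ) 1))
    (hUA : IndepOf μ U A) (hξ : MemLp ξ 2 μ) (hξG : StronglyMeasurable[G] ξ)
    (hξA : μ[ξ | A] =ᵐ[μ] 0) (hηG : ∀ n, StronglyMeasurable[G] (η n)) (hη : ∀ n, MemLp (η n) 2 μ)
    (hind : ∀ n, IndepOf μ (η n) A) (hmean : ∀ n, ∫ ω, η n ω ∂μ = 0) {c : ℝ}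
    (hnorm : ∀ n, ⟪(memLp_sub_sum hξ hη (Finset.range n)).toLp _, (hη n).toLp (η n)⟫ =
      ‖(hη n).toLp (η n)‖ ^ 2)
    (hbest : ∀ n, ∀ g ∈ indepCentered A G μ m,
      |⟪(memLp_sub_sum hξ hη (Finset.range n)).toLp _, g⟫| ≤ c * ‖(hη n).toLp (η n)‖ * ‖g‖) :
    IsIndepExpansion μ A G ξ η := by
  have hA := hAG.trans hG
  have hcond : ∀ n, μ[η n | A] =ᵐ[μ] 0 := fun n =>
    condExp_eq_zero_of_indepOf hA ((hηG n).mono hG) (hind n) (hmean n)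
  simp_rw [toLp_sub_sum hξ hη] at hnorm hbest
  obtain ⟨y, hy, hyD⟩ := exists_tendsto_residual_of_weakGreedy (D := indepCentered A G μ m)
    (fun n => ⟨η n, hηG n, hind n, (hη n).coeFn_toLp, hmean n⟩) hnorm hbest
  simp_rw [← toLp_sub_sum hξ hη] at hy
  -- Measurability and conditional centredness are closed conditions in L², so the limit inherits
  -- them; the latter is tested against the vectors 1_T c with T ∈ A.
  have hyG : AEStronglyMeasurable[G] y μ := by
    refine (isClosed_aestronglyMeasurable hG).mem_of_tendsto hy (Eventually.of_forall fun n => ?_)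
    exact ⟨_, hξG.sub (Finset.stronglyMeasurable_sum _ fun i _ => hηG i), MemLp.coeFn_toLp _⟩
  have hset : ∀ (T : Set Ω) (hT : MeasurableSet[A] T) (c : EuclideanSpace ℝ (Fin m))
      {f : Ω → EuclideanSpace ℝ (Fin m)} (hf : MemLp f 2 μ), μ[f | A] =ᵐ[μ] 0 →
      ⟪indicatorConstLp 2 (hA T hT) (measure_ne_top μ T) c, hf.toLp f⟫ = 0 := by
    intro T hT c f hf hfA
    rw [L2.inner_indicatorConstLp_eq_inner_setIntegral,
      setIntegral_congr_ae (hA T hT) (hf.coeFn_toLp.mono fun ω h _ => h),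
      ← setIntegral_condExp hA (hf.integrable (by norm_num)) hT,
      setIntegral_congr_ae (hA T hT) (hfA.mono fun ω h _ => h)]
    simp
  have hyA : ∀ T, MeasurableSet[A] T → ∫ ω in T, y ω ∂μ = 0 := by
    intro T hT
    refine ext_inner_left ℝ fun c => ?_
    rw [← L2.inner_indicatorConstLp_eq_inner_setIntegral ℝ (hA T hT) (measure_ne_top μ T) c y,
      inner_zero_right]
    have h1 : Tendsto (fun n => ⟪indicatorConstLp 2 (hA T hT) (measure_ne_top μ T) c,
        (memLp_sub_sum hξ hη (Finset.range n)).toLp _⟫) atTop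
        (𝓝 ⟪indicatorConstLp 2 (hA T hT) (measure_ne_top μ T) c, y⟫) :=
      tendsto_const_nhds.inner hy
    refine tendsto_nhds_unique h1 (tendsto_const_nhds.congr fun n => ?_)
    rw [toLp_sub_sum hξ hη, inner_sub_right, inner_sum, hset T hT c hξ hξA,
      Finset.sum_eq_zero fun i _ => hset T hT c (hη i) (hcond i), sub_zero]
  have hy0 := eq_zero_of_forall_inner_indepCentered_eq_zero hAG hG hU hUlaw hUA hyG hyA hyD
  refine ⟨hηG, hη, hind, hcond, fun n => ?_, ?_⟩
  · rw [l2norm_eq_norm_toLp hξ, l2norm_eq_norm_toLp (memLp_sub_sum hξ hη _), toLp_sub_sum hξ hη,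
      norm_sq_eq_norm_sq_sub_sum_add hnorm n]
    simp_rw [l2norm_eq_norm_toLp (hη _)]
  · rw [hy0] at hy
    have h := hy.enorm
    simp_rw [Lp.enorm_toLp, enorm_zero] at h
    exact h

theorem exists_isIndepExpansion (hAG : A ≤ G) (hG : G ≤ mΩ) {U : Ω → ℝ}
    (hU : Measurable[G] U) (hUlaw : μ.map U = volume.restrict (Set.Icc (0 : ℝ) 1))
    (hUA : IndepOf μ U A) (hξ : MemLp ξ 2 μ) (hξG : StronglyMeasurable[G] ξ)
    (hξA : μ[ξ | A] =ᵐ[μ] 0) : ∃ η, IsIndepExpansion μ A G ξ η := by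
  obtain ⟨e, he⟩ := exists_weakGreedy (zero_mem_indepCentered (A := A) (G := G) (μ := μ) (m := m))
    (fun t g hg => smul_mem_indepCentered t hg) (hξ.toLp ξ)
  choose heD henorm hebest using he
  choose η hηG hind heη hmean using heD
  have hη : ∀ n, MemLp (η n) 2 μ := fun n => (memLp_congr_ae (heη n)).1 (Lp.memLp (e n))
  have heq : ∀ n, (hη n).toLp (η n) = e n := fun n => by
    rw [← Lp.toLp_coeFn (e n) (Lp.memLp (e n))]
    exact MemLp.toLp_congr _ _ (heη n).symm
  refine ⟨η, isIndepExpansion_of_weakGreedy hAG hG hU hUlaw hUA hξ hξG hξA hηG hη hind hmean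
    (c := 2) (fun n => ?_) fun n g hg => ?_⟩
  · simp_rw [toLp_sub_sum hξ hη, heq]
    exact henorm n
  · simp_rw [toLp_sub_sum hξ hη, heq]
    exact hebest n g hg

/-- Zero is an admissible competitor, so the error is at most ‖ξ‖ and hence finite. -/
theorem IsBestIndepApprox.memLp {η : Ω → EuclideanSpace ℝ (Fin m)}
    (h : IsBestIndepApprox μ A G ξ η) (hG : G ≤ mΩ) (hξ : MemLp ξ 2 μ) : MemLp η 2 μ := by
  have h0 : eLpNorm (ξ - η) 2 μ ≤ eLpNorm ξ 2 μ := by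
    have := h.le (fun _ => 0) stronglyMeasurable_const (by
      unfold IndepOf
      rw [MeasurableSpace.comap_const]
      exact indep_bot_left A)
    convert this using 2
    ext1 ω
    simp
  have h1 : MemLp (ξ - η) 2 μ :=
    ⟨hξ.1.sub (h.stronglyMeasurable.mono hG).aestronglyMeasurable, h0.trans_lt hξ.2⟩
  simpa using hξ.sub h1

/-- η - M, with M the mean of η, is an admissible competitor. As ξ is centred, its squared error is
smaller by ‖M‖², which forces M = 0. -/
theorem IsBestIndepApprox.integral_eq_zero {η : Ω → EuclideanSpace ℝ (Fin m)}
    (h : IsBestIndepApprox μ A G ξ η) (hG : G ≤ mΩ) (hξ : MemLp ξ 2 μ)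
    (hξ0 : ∫ ω, ξ ω ∂μ = 0) : ∫ ω, η ω ∂μ = 0 := by
  have hη := h.memLp hG hξ
  set M := ∫ ω, η ω ∂μ with hM
  have hc : MemLp (fun _ : Ω => M) 2 μ := memLp_const M
  have hinner : ∀ {f : Ω → EuclideanSpace ℝ (Fin m)} (hf : MemLp f 2 μ),
      ⟪hf.toLp f, hc.toLp _⟫ = ⟪∫ ω, f ω ∂μ, M⟫ := by
    intro f hf
    rw [inner_toLp_eq_integral, real_inner_comm, ← integral_inner (hf.integrable (by norm_num)) M]
    simp_rw [real_inner_comm]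
  have h1 := norm_sub_toLp_le_of_isBestIndepApprox h hξ hη (hη.sub hc)
    (h.stronglyMeasurable.sub stronglyMeasurable_const)
    (h.indep.comp (φ := fun x => x - M) (measurable_id.sub_const M))
  rw [MemLp.toLp_sub hη hc, ← sub_add] at h1
  have h2 := pow_le_pow_left₀ (norm_nonneg _) h1 2
  rw [norm_add_sq_real, inner_sub_left, hinner, hinner, ← real_inner_self_eq_norm_sq (hc.toLp _),
    hinner, hξ0, ← hM, inner_zero_left, integral_const, probReal_univ, one_smul,
    real_inner_self_eq_norm_sq] at h2
  have h3 : ‖M‖ ^ 2 ≤ 0 := by linarith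
  exact norm_eq_zero.1 (pow_eq_zero_iff two_ne_zero |>.1 (le_antisymm h3 (sq_nonneg _)))

theorem IsGreedyExpansion.isIndepExpansion (h : IsGreedyExpansion μ A G ξ η) (hAG : A ≤ G)
    (hG : G ≤ mΩ) {U : Ω → ℝ} (hU : Measurable[G] U)
    (hUlaw : μ.map U = volume.restrict (Set.Icc (0 : ℝ) 1)) (hUA : IndepOf μ U A)
    (hξ : MemLp ξ 2 μ) (hξG : StronglyMeasurable[G] ξ) (hξA : μ[ξ | A] =ᵐ[μ] 0) :
    IsIndepExpansion μ A G ξ η := by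
  -- Integrability and mean of the n-th residual depend on all earlier terms, hence strong
  -- induction.
  have hboth : ∀ n, MemLp (η n) 2 μ ∧ ∫ ω, η n ω ∂μ = 0 := by
    intro n
    induction n using Nat.strong_induction_on with
    | _ n ih =>
      have hres : MemLp (ξ - ∑ i ∈ Finset.range n, η i) 2 μ :=
        hξ.sub (memLp_finsetSum' _ fun i hi => (ih i (Finset.mem_range.1 hi)).1)
      refine ⟨(h n).memLp hG hres, (h n).integral_eq_zero hG hres ?_⟩
      have hint : ∀ i ∈ Finset.range n, Integrable (η i) μ := fun i hi =>
        (ih i (Finset.mem_range.1 hi)).1.integrable (by norm_num)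
      rw [integral_sub' (hξ.integrable (by norm_num)) (integrable_finsetSum' _ hint),
        integral_eq_zero_of_condExp_eq_zero (hAG.trans hG) hξA]
      simp_rw [Finset.sum_apply]
      rw [integral_finsetSum _ hint,
        Finset.sum_eq_zero fun i hi => (ih i (Finset.mem_range.1 hi)).2, sub_zero]
  have hη := fun n => (hboth n).1
  refine isIndepExpansion_of_weakGreedy hAG hG hU hUlaw hUA hξ hξG hξA
    (fun n => (h n).stronglyMeasurable) hη (fun n => (h n).indep) (fun n => (hboth n).2) (c := 1)
    (fun n => (h n).inner_eq_norm_sq _ _) fun n g hg => ?_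
  rw [one_mul]
  exact (h n).abs_inner_le _ _ hg

end Expansion

/-! ### Square integrable martingales: orthogonality and convergence. -/

section Martingale

open scoped RealInnerProductSpace

variable {Ω : Type*} {A mΩ : MeasurableSpace Ω} {μ : Measure Ω} {m : ℕ}
  {f g : Ω → EuclideanSpace ℝ (Fin m)} {ℱ : Filtration ℕ mΩ}
  {X : ℕ → Ω → EuclideanSpace ℝ (Fin m)} {x : Ω → EuclideanSpace ℝ (Fin m)}

theorem l2norm_nonneg : 0 ≤ l2norm μ f := ENNReal.toReal_nonneg

theorem l2norm_congr_ae (h : f =ᵐ[μ] g) : l2norm μ f = l2norm μ g := by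
  rw [l2norm, l2norm, eLpNorm_congr_ae h]

theorem L2Bounded.memLp (h : L2Bounded μ X) (hX : Martingale X ℱ μ) (k : ℕ) : MemLp (X k) 2 μ := by
  obtain ⟨C, hC⟩ := h
  exact ⟨(hX.integrable k).1, (hC k).trans_lt ENNReal.coe_lt_top⟩

theorem l2norm_le_of_eLpNorm_le {C : ℝ≥0} (h : eLpNorm f 2 μ ≤ C) : l2norm μ f ≤ C :=
  ENNReal.toReal_le_coe_of_le_coe h

theorem tendsto_l2norm_of_tendsto_eLpNorm_sub (hX : ∀ k, MemLp (X k) 2 μ) (hx : MemLp x 2 μ)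
    (h : Tendsto (fun k => eLpNorm (X k - x) 2 μ) atTop (𝓝 0)) :
    Tendsto (fun k => l2norm μ (X k)) atTop (𝓝 (l2norm μ x)) := by
  simp_rw [l2norm_eq_norm_toLp (hX _), l2norm_eq_norm_toLp hx]
  exact ((Lp.tendsto_Lp_iff_tendsto_eLpNorm'' X hX x hx).2 h).norm

/-- Split off the largest index: its variable is independent of a sigma-algebra that contains the
events of all the others. -/
theorem iIndepFun_of_indepOf_filtration [IsProbabilityMeasure μ] {β : Type*} [MeasurableSpace β]
    {Y : ℕ → Ω → β} (hY : ∀ k, Measurable[ℱ (k + 1)] (Y k)) (hind : ∀ k, IndepOf μ (Y k) (ℱ k)) :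
    iIndepFun Y μ := by
  rw [iIndepFun_iff_measure_inter_preimage_eq_mul]
  intro S
  induction S using Finset.induction_on_max with
  | empty => simp
  | insert a s ha ih =>
    intro sets hsets
    rw [Finset.set_biInter_insert, Finset.prod_insert fun h => lt_irrefl a (ha a h),
      ← ih fun i hi => hsets i (Finset.mem_insert_of_mem hi)]
    refine (Indep_iff _ _ μ).1 (hind a) _ _ ⟨sets a, hsets a (Finset.mem_insert_self a s), rfl⟩ ?_
    refine Finset.measurableSet_biInter s fun i hi => ?_
    exact ℱ.mono (ha i hi) _ (hY i (hsets i (Finset.mem_insert_of_mem hi)))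

theorem MeasureTheory.Martingale.condExp_sub_eq_zero (hX : Martingale X ℱ μ) {j k : ℕ}
    (hjk : j ≤ k) : μ[X k - X j | ℱ j] =ᵐ[μ] 0 := by
  filter_upwards [condExp_sub (hX.integrable k) (hX.integrable j) (ℱ j), hX.condExp_ae_eq hjk,
    hX.condExp_ae_eq le_rfl] with ω h1 h2 h3
  rw [h1, Pi.sub_apply, h2, h3, sub_self, Pi.zero_apply]

variable [IsProbabilityMeasure μ]

theorem inner_toLp_eq_zero_of_condExp_eq_zero (hA : A ≤ mΩ) (hf : MemLp f 2 μ) (hg : MemLp g 2 μ)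
    (hfA : StronglyMeasurable[A] f) (hgA : μ[g | A] =ᵐ[μ] 0) :
    ⟪hf.toLp f, hg.toLp g⟫ = 0 := by
  have hint : Integrable (fun ω => ⟪f ω, g ω⟫) μ := by
    refine (L2.integrable_inner (𝕜 := ℝ) (hf.toLp f) (hg.toLp g)).congr ?_
    filter_upwards [hf.coeFn_toLp, hg.coeFn_toLp] with ω h1 h2
    rw [h1, h2]
  have h : μ[fun ω => ⟪f ω, g ω⟫ | A] =ᵐ[μ] fun ω => ⟪f ω, (μ[g | A]) ω⟫ :=
    condExp_bilin_of_stronglyMeasurable_left (innerSL ℝ) hfA hint (hg.integrable (by norm_num))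
  rw [inner_toLp_eq_integral]
  rw [← integral_condExp hA, integral_congr_ae h, integral_congr_ae (g := fun _ => (0 : ℝ)) ?_]
  · simp
  · filter_upwards [hgA] with ω h1
    rw [h1, Pi.zero_apply, inner_zero_right]

theorem l2norm_sub_sq_of_martingale (hX : Martingale X ℱ μ) (hL : ∀ k, MemLp (X k) 2 μ) {j k : ℕ}
    (hjk : j ≤ k) : l2norm μ (X k - X j) ^ 2 = l2norm μ (X k) ^ 2 - l2norm μ (X j) ^ 2 := by
  have h := inner_toLp_eq_zero_of_condExp_eq_zero (ℱ.le j) (hL j) ((hL k).sub (hL j))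
    (hX.stronglyAdapted j) (hX.condExp_sub_eq_zero hjk)
  rw [l2norm_eq_norm_toLp ((hL k).sub (hL j)), l2norm_eq_norm_toLp (hL k),
    l2norm_eq_norm_toLp (hL j)]
  have h2 : (hL k).toLp (X k) = (hL j).toLp (X j) + ((hL k).sub (hL j)).toLp (X k - X j) := by
    rw [MemLp.toLp_sub (hL k) (hL j), add_sub_cancel]
  rw [h2, norm_add_sq_real, h]
  ring

theorem l2norm_sq_eq_sum_of_martingale (hX : Martingale X ℱ μ) (hL : ∀ k, MemLp (X k) 2 μ)
    (h0 : X 0 =ᵐ[μ] 0) (k : ℕ) :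
    l2norm μ (X k) ^ 2 = ∑ s ∈ Finset.range k, l2norm μ (X (s + 1) - X s) ^ 2 := by
  simp_rw [l2norm_sub_sq_of_martingale hX hL (Nat.le_succ _)]
  rw [Finset.sum_range_sub (fun s => l2norm μ (X s) ^ 2), l2norm_congr_ae h0]
  simp [l2norm]

/-- Conditional expectation contracts L², while 𝔼[X_k - x | ℱ_n] no longer depends on k once k ≥ n.
-/
theorem MeasureTheory.Martingale.condExp_ae_eq_of_tendsto_l2 (hX : Martingale X ℱ μ)
    (hL : ∀ k, MemLp (X k) 2 μ) (hx : MemLp x 2 μ)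
    (h : Tendsto (fun k => eLpNorm (X k - x) 2 μ) atTop (𝓝 0)) (n : ℕ) : μ[x | ℱ n] =ᵐ[μ] X n := by
  have hxi : Integrable x μ := hx.integrable (by norm_num)
  have ht : Tendsto (fun k => eLpNorm (μ[X k - x | ℱ n]) 2 μ) atTop (𝓝 0) :=
    tendsto_of_tendsto_of_tendsto_of_le_of_le tendsto_const_nhds h (fun _ => zero_le)
      fun k => eLpNorm_condExp_le_eLpNorm _ (by norm_num)
  have hev : ∀ k ≥ n, eLpNorm (μ[X k - x | ℱ n]) 2 μ = eLpNorm (X n - μ[x | ℱ n]) 2 μ := by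
    refine fun k hk => eLpNorm_congr_ae ((condExp_sub (hX.integrable k) hxi _).trans ?_)
    filter_upwards [hX.condExp_ae_eq hk] with ω hω
    simp only [hω, Pi.sub_apply]
  have h0 := tendsto_nhds_unique (tendsto_atTop_of_eventually_const hev) ht
  rw [eLpNorm_eq_zero_iff ((hL n).1.sub integrable_condExp.1) two_ne_zero] at h0
  filter_upwards [h0] with ω hω
  exact (sub_eq_zero.1 hω).symm

/-- The convergence theorem for L¹-bounded real martingales gives a limit in each coordinate; an
almost surely convergent subsequence identifies it as x. -/
theorem MeasureTheory.Martingale.ae_tendsto_of_tendsto_l2 (hX : Martingale X ℱ μ)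
    (hb : L2Bounded μ X) (hx : MemLp x 2 μ)
    (h : Tendsto (fun k => eLpNorm (X k - x) 2 μ) atTop (𝓝 0)) :
    ∀ᵐ ω ∂μ, Tendsto (fun k => X k ω) atTop (𝓝 (x ω)) := by
  obtain ⟨ns, hns, hsub⟩ := (tendstoInMeasure_of_tendsto_eLpNorm two_ne_zero
    (fun k => (hX.integrable k).1) hx.1 h).exists_seq_tendsto_ae
  obtain ⟨C, hC⟩ := hb
  have hcoord : ∀ i : Fin m, ∀ᵐ ω ∂μ, ∃ l, Tendsto (fun k => X k ω i) atTop (𝓝 l) := by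
    intro i
    set T : EuclideanSpace ℝ (Fin m) →L[ℝ] ℝ := EuclideanSpace.proj i with hT
    have hmart : Martingale (fun k => T ∘ X k) ℱ μ := by
      refine ⟨fun k => T.continuous.comp_stronglyMeasurable (hX.stronglyAdapted k), fun j k hjk => ?_⟩
      refine (T.comp_condExp_comm (hX.integrable k)).symm.trans ?_
      filter_upwards [hX.condExp_ae_eq hjk] with ω hω
      simp only [Function.comp_apply, hω]
    have hbd : ∀ k, eLpNorm (T ∘ X k) 1 μ ≤ C := by
      intro k
      refine le_trans ?_ (hC k)
      refine le_trans (eLpNorm_mono (g := X k) fun ω => PiLp.norm_apply_le (X k ω) i) ?_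
      exact eLpNorm_le_eLpNorm_of_exponent_le (by norm_num) (hX.integrable k).1
    filter_upwards [hmart.submartingale.ae_tendsto_limitProcess hbd] with ω hω
    exact ⟨_, hω⟩
  filter_upwards [hsub, ae_all_iff.2 hcoord] with ω h1 h2
  have h3 : ∀ i, Tendsto (fun k => X k ω i) atTop (𝓝 (x ω i)) := by
    intro i
    obtain ⟨l, hl⟩ := h2 i
    have h4 : Tendsto (fun k => X (ns k) ω i) atTop (𝓝 (x ω i)) :=
      ((EuclideanSpace.proj (𝕜 := ℝ) i).continuous.tendsto (x ω)).comp h1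
    rwa [tendsto_nhds_unique h4 (hl.comp hns.tendsto_atTop)]
  exact ((PiLp.continuous_toLp 2 fun _ : Fin m => ℝ).tendsto _).comp (tendsto_pi_nhds.2 h3)

/-- `L²`-bounded martingales converge. -/
theorem exists_isTerminalValue (hX : Martingale X ℱ μ) (hb : L2Bounded μ X) :
    ∃ x, IsTerminalValue μ ℱ X x := by
  have hL := hb.memLp hX
  obtain ⟨C, hC⟩ := id hb
  have hmono : Monotone fun k => l2norm μ (X k) ^ 2 := by
    intro j k hjk
    have := l2norm_sub_sq_of_martingale hX hL hjk
    have h2 := sq_nonneg (l2norm μ (X k - X j))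
    simp only
    linarith
  have hbdd : BddAbove (Set.range fun k => l2norm μ (X k) ^ 2) := by
    refine ⟨(C : ℝ) ^ 2, ?_⟩
    rintro _ ⟨k, rfl⟩
    exact pow_le_pow_left₀ l2norm_nonneg (l2norm_le_of_eLpNorm_le (hC k)) 2
  have hlim := tendsto_atTop_ciSup hmono hbdd
  set L := ⨆ k, l2norm μ (X k) ^ 2 with hLdef
  -- Squared distances are differences of the squared norms, which increase to a finite limit.
  have hcauchy : CauchySeq fun k => (hL k).toLp (X k) := by
    rw [Metric.cauchySeq_iff']
    intro ε hε
    obtain ⟨N, hN⟩ := (hlim.eventually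
      (lt_mem_nhds (sub_lt_self L (pow_pos hε 2)))).exists
    refine ⟨N, fun n hn => ?_⟩
    rw [dist_eq_norm, ← MemLp.toLp_sub, ← l2norm_eq_norm_toLp]
    refine lt_of_pow_lt_pow_left₀ 2 hε.le ?_
    rw [l2norm_sub_sq_of_martingale hX hL hn]
    have : l2norm μ (X n) ^ 2 ≤ L := le_ciSup hbdd n
    linarith
  obtain ⟨y, hy⟩ := cauchySeq_tendsto_of_complete hcauchy
  have hyL := Lp.memLp y
  have hlim2 : Tendsto (fun k => eLpNorm (X k - ⇑y) 2 μ) atTop (𝓝 0) := by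
    rw [← Lp.tendsto_Lp_iff_tendsto_eLpNorm'' X hL y hyL, Lp.toLp_coeFn]
    exact hy
  exact ⟨y, hyL, hlim2, hX.ae_tendsto_of_tendsto_l2 hb hyL hlim2,
    hX.condExp_ae_eq_of_tendsto_l2 hL hyL hlim2⟩

end Martingale

/-! ### Summation over time and passage to the terminal values. -/

section Decomposition

variable {Ω : Type*} {mΩ : MeasurableSpace Ω} {μ : Measure Ω} {m : ℕ}
  {ℱ : Filtration ℕ mΩ} {X : ℕ → Ω → EuclideanSpace ℝ (Fin m)}
  {Y : ℕ → ℕ → Ω → EuclideanSpace ℝ (Fin m)}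

theorem hasSum_of_forall_eq_add_sum_range {a : ℝ} {b c : ℕ → ℝ} (hc : ∀ n, 0 ≤ c n)
    (h : ∀ N, a = b N + ∑ n ∈ Finset.range N, c n) (hb : Tendsto b atTop (𝓝 0)) : HasSum c a := by
  rw [hasSum_iff_tendsto_nat_of_nonneg hc]
  have h1 : (fun N => ∑ n ∈ Finset.range N, c n) = fun N => a - b N :=
    funext fun N => by rw [h N, add_sub_cancel_left]
  rw [h1]
  simpa using (tendsto_const_nhds (x := a)).sub hb

theorem tendsto_l2norm_sq_zero_iff {f : ℕ → Ω → EuclideanSpace ℝ (Fin m)}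
    (hf : ∀ n, MemLp (f n) 2 μ) :
    Tendsto (fun n => l2norm μ (f n) ^ 2) atTop (𝓝 0) ↔
      Tendsto (fun n => eLpNorm (f n) 2 μ) atTop (𝓝 0) := by
  rw [← ENNReal.tendsto_toReal_iff (fun n => (hf n).2.ne) ENNReal.zero_ne_top, ENNReal.toReal_zero]
  refine ⟨fun h => ?_, fun h => ?_⟩
  · have := h.sqrt
    simp only [Real.sqrt_zero, Real.sqrt_sq l2norm_nonneg] at this
    exact this
  · have := h.pow 2
    simpa [l2norm] using this

theorem sumProcess_succ_sub (Y : ℕ → Ω → EuclideanSpace ℝ (Fin m)) (k : ℕ) :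
    sumProcess Y (k + 1) - sumProcess Y k = Y (k + 1) := by
  simp only [sumProcess, Finset.sum_range_succ, add_sub_cancel_left]

theorem martingale_finsetSum {ι : Type*} {Z : ι → ℕ → Ω → EuclideanSpace ℝ (Fin m)}
    (hZ : ∀ i, Martingale (Z i) ℱ μ) (s : Finset ι) : Martingale (∑ i ∈ s, Z i) ℱ μ := by
  classical
  induction s using Finset.induction_on with
  | empty => simpa using martingale_zero (EuclideanSpace ℝ (Fin m)) ℱ μ
  | insert a s ha ih =>
    rw [Finset.sum_insert ha]
    exact (hZ a).add ih

theorem memLp_sumProcess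
    (hY : ∀ k, IsIndepExpansion μ (ℱ k) (ℱ (k + 1)) (X (k + 1) - X k) fun n => Y n (k + 1))
    (n k : ℕ) : MemLp (sumProcess (Y n) k) 2 μ :=
  memLp_finsetSum' _ fun s _ => (hY s).memLp n

theorem tendsto_l2norm_increment_residual_sq (hL : ∀ k, MemLp (X k) 2 μ)
    (hY : ∀ k, IsIndepExpansion μ (ℱ k) (ℱ (k + 1)) (X (k + 1) - X k) fun n => Y n (k + 1))
    (s : ℕ) : Tendsto (fun N => l2norm μ (X (s + 1) - X s - ∑ n ∈ Finset.range N, Y n (s + 1)) ^ 2)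
      atTop (𝓝 0) :=
  (tendsto_l2norm_sq_zero_iff fun N =>
    memLp_sub_sum ((hL (s + 1)).sub (hL s)) (hY s).memLp (Finset.range N)).2 (hY s).hasL2Sum

variable [IsProbabilityMeasure μ]

theorem martingale_sumProcess
    (hY : ∀ k, IsIndepExpansion μ (ℱ k) (ℱ (k + 1)) (X (k + 1) - X k) fun n => Y n (k + 1))
    (n : ℕ) : Martingale (sumProcess (Y n)) ℱ μ := by
  refine martingale_of_condExp_sub_eq_zero_nat (fun k => ?_)
    (fun k => (memLp_sumProcess hY n k).integrable (by norm_num)) fun k => ?_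
  · refine Finset.stronglyMeasurable_sum _ fun s hs => ?_
    exact ((hY s).stronglyMeasurable n).mono (ℱ.mono (Finset.mem_range.1 hs))
  · rw [sumProcess_succ_sub]
    exact (hY k).condExp_eq_zero n

theorem l2norm_sumProcess_sq
    (hY : ∀ k, IsIndepExpansion μ (ℱ k) (ℱ (k + 1)) (X (k + 1) - X k) fun n => Y n (k + 1))
    (n k : ℕ) : l2norm μ (sumProcess (Y n) k) ^ 2 =
      ∑ s ∈ Finset.range k, l2norm μ (Y n (s + 1)) ^ 2 := by
  rw [l2norm_sq_eq_sum_of_martingale (martingale_sumProcess hY n) (memLp_sumProcess hY n)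
    (by simp [sumProcess])]
  simp_rw [sumProcess_succ_sub]

theorem martingale_residual (hX : Martingale X ℱ μ)
    (hY : ∀ k, IsIndepExpansion μ (ℱ k) (ℱ (k + 1)) (X (k + 1) - X k) fun n => Y n (k + 1))
    (N : ℕ) : Martingale (fun k => X k - ∑ n ∈ Finset.range N, sumProcess (Y n) k) ℱ μ := by
  have h := hX.sub (martingale_finsetSum (martingale_sumProcess hY) (Finset.range N))
  convert h using 1
  ext1 k
  rw [Pi.sub_apply, Finset.sum_apply]

/-- The residual process is a martingale whose increments are the residuals of the increments of X,
and these are orthogonal. -/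
theorem l2norm_residual_sq (hX : Martingale X ℱ μ) (hX0 : X 0 =ᵐ[μ] 0) (hL : ∀ k, MemLp (X k) 2 μ)
    (hY : ∀ k, IsIndepExpansion μ (ℱ k) (ℱ (k + 1)) (X (k + 1) - X k) fun n => Y n (k + 1))
    (N k : ℕ) : l2norm μ (X k - ∑ n ∈ Finset.range N, sumProcess (Y n) k) ^ 2 =
      ∑ s ∈ Finset.range k,
        l2norm μ (X (s + 1) - X s - ∑ n ∈ Finset.range N, Y n (s + 1)) ^ 2 := by
  rw [l2norm_sq_eq_sum_of_martingale (martingale_residual hX hY N)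
    (fun k => memLp_sub_sum (hL k) (fun n => memLp_sumProcess hY n k) _) (by simpa [sumProcess])]
  refine Finset.sum_congr rfl fun s _ => ?_
  rw [sub_sub_sub_comm, ← Finset.sum_sub_distrib]
  simp_rw [sumProcess_succ_sub]

/-- Sum the identities for the single increments over time; no orthogonality between different Z^n
is used. -/
theorem l2norm_sq_eq_residual_add_sum (hX : Martingale X ℱ μ) (hX0 : X 0 =ᵐ[μ] 0)
    (hL : ∀ k, MemLp (X k) 2 μ)
    (hY : ∀ k, IsIndepExpansion μ (ℱ k) (ℱ (k + 1)) (X (k + 1) - X k) fun n => Y n (k + 1))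
    (k N : ℕ) : l2norm μ (X k) ^ 2 =
      l2norm μ (X k - ∑ n ∈ Finset.range N, sumProcess (Y n) k) ^ 2 +
        ∑ n ∈ Finset.range N, l2norm μ (sumProcess (Y n) k) ^ 2 := by
  rw [l2norm_sq_eq_sum_of_martingale hX hL hX0, l2norm_residual_sq hX hX0 hL hY]
  simp_rw [l2norm_sumProcess_sq hY]
  rw [Finset.sum_comm, ← Finset.sum_add_distrib]
  exact Finset.sum_congr rfl fun s _ => (hY s).norm_sq N

theorem isIndepIncrementDecomposition_sumProcess (hX : Martingale X ℱ μ) (hX0 : X 0 =ᵐ[μ] 0)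
    (hL : ∀ k, MemLp (X k) 2 μ)
    (hY : ∀ k, IsIndepExpansion μ (ℱ k) (ℱ (k + 1)) (X (k + 1) - X k) fun n => Y n (k + 1)) :
    IsIndepIncrementDecomposition μ ℱ X fun n => sumProcess (Y n) := by
  have hres : ∀ k, Tendsto
      (fun N => l2norm μ (X k - ∑ n ∈ Finset.range N, sumProcess (Y n) k) ^ 2) atTop (𝓝 0) := by
    intro k
    simp_rw [l2norm_residual_sq hX hX0 hL hY]
    rw [← Finset.sum_const_zero (s := Finset.range k)]
    exact tendsto_finsetSum _ fun s _ => tendsto_l2norm_increment_residual_sq hL hY s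
  refine ⟨martingale_sumProcess hY, memLp_sumProcess hY, fun n => by simp [sumProcess],
    fun n k => ?_, fun n => ?_, fun k => ?_, fun k => ?_⟩
  · rw [sumProcess_succ_sub]
    exact (hY k).indep n
  · simp_rw [sumProcess_succ_sub]
    exact iIndepFun_of_indepOf_filtration (fun k => ((hY k).stronglyMeasurable n).measurable)
      fun k => (hY k).indep n
  · exact (tendsto_l2norm_sq_zero_iff fun N =>
      memLp_sub_sum (hL k) (fun n => memLp_sumProcess hY n k) (Finset.range N)).1 (hres k)
  · exact hasSum_of_forall_eq_add_sum_range (fun n => sq_nonneg _)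
      (l2norm_sq_eq_residual_add_sum hX hX0 hL hY k) (hres k)

theorem boundedness_of_sumProcess (hX : Martingale X ℱ μ) (hX0 : X 0 =ᵐ[μ] 0) (hb : L2Bounded μ X)
    (hY : ∀ k, IsIndepExpansion μ (ℱ k) (ℱ (k + 1)) (X (k + 1) - X k) fun n => Y n (k + 1))
    (n : ℕ) : L2Bounded μ (sumProcess (Y n)) := by
  have hL := hb.memLp hX
  obtain ⟨C, hC⟩ := hb
  refine ⟨C, fun k => ?_⟩
  have h1 : l2norm μ (sumProcess (Y n) k) ^ 2 ≤ l2norm μ (X k) ^ 2 :=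
    le_hasSum ((isIndepIncrementDecomposition_sumProcess hX hX0 hL hY).norm_sq k) n
      fun i _ => sq_nonneg _
  have h2 := (abs_le_of_sq_le_sq h1 l2norm_nonneg).trans (l2norm_le_of_eLpNorm_le (hC k))
  rw [abs_of_nonneg l2norm_nonneg, l2norm] at h2
  rw [← ENNReal.ofReal_toReal (memLp_sumProcess hY n k).2.ne, ← ENNReal.ofReal_coe_nnreal]
  exact ENNReal.ofReal_le_ofReal h2

theorem hasL2Sum_terminalValue (hX : Martingale X ℱ μ) (hX0 : X 0 =ᵐ[μ] 0) (hb : L2Bounded μ X)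
    (hY : ∀ k, IsIndepExpansion μ (ℱ k) (ℱ (k + 1)) (X (k + 1) - X k) fun n => Y n (k + 1))
    {x : Ω → EuclideanSpace ℝ (Fin m)} (hx : IsTerminalValue μ ℱ X x)
    {z : ℕ → Ω → EuclideanSpace ℝ (Fin m)}
    (hz : ∀ n, IsTerminalValue μ ℱ (sumProcess (Y n)) (z n)) :
    HasL2Sum μ z x ∧ HasSum (fun n => l2norm μ (z n) ^ 2) (l2norm μ x ^ 2) := by
  have hL := hb.memLp hX
  have hZL := memLp_sumProcess hY
  have hzL : ∀ n, MemLp (z n) 2 μ := fun n => (hz n).memLp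
  have hRL : ∀ N k, MemLp (X k - ∑ n ∈ Finset.range N, sumProcess (Y n) k) 2 μ := fun N k =>
    memLp_sub_sum (hL k) (fun n => hZL n k) _
  have hrL : ∀ N, MemLp (x - ∑ n ∈ Finset.range N, z n) 2 μ := fun N =>
    memLp_sub_sum hx.memLp hzL _
  have hlimX := tendsto_l2norm_of_tendsto_eLpNorm_sub hL hx.memLp hx.tendsto_l2
  have hlimZ := fun n => tendsto_l2norm_of_tendsto_eLpNorm_sub (hZL n) (hzL n) (hz n).tendsto_l2
  have hlimR : ∀ N, Tendsto (fun k => l2norm μ (X k - ∑ n ∈ Finset.range N, sumProcess (Y n) k))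
      atTop (𝓝 (l2norm μ (x - ∑ n ∈ Finset.range N, z n))) := by
    intro N
    simp_rw [l2norm_eq_norm_toLp (hRL N _), l2norm_eq_norm_toLp (hrL N), toLp_sub_sum hx.memLp hzL,
      toLp_sub_sum (hL _) fun n => hZL n _]
    refine (Tendsto.sub ?_ (tendsto_finsetSum _ fun n _ => ?_)).norm
    · exact (Lp.tendsto_Lp_iff_tendsto_eLpNorm'' X hL x hx.memLp).2 hx.tendsto_l2
    · exact (Lp.tendsto_Lp_iff_tendsto_eLpNorm'' _ (hZL n) (z n) (hzL n)).2 (hz n).tendsto_l2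
  have hsum : ∀ N, l2norm μ x ^ 2 = l2norm μ (x - ∑ n ∈ Finset.range N, z n) ^ 2 +
      ∑ n ∈ Finset.range N, l2norm μ (z n) ^ 2 := by
    intro N
    refine tendsto_nhds_unique (hlimX.pow 2) ?_
    simp_rw [l2norm_sq_eq_residual_add_sum hX hX0 hL hY _ N]
    exact ((hlimR N).pow 2).add (tendsto_finsetSum _ fun n _ => (hlimZ n).pow 2)
  have hXsum : HasSum (fun s => l2norm μ (X (s + 1) - X s) ^ 2) (l2norm μ x ^ 2) := by
    rw [hasSum_iff_tendsto_nat_of_nonneg fun s => sq_nonneg _]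
    simp_rw [← l2norm_sq_eq_sum_of_martingale hX hL hX0]
    exact hlimX.pow 2
  have hRsum : ∀ N, HasSum
      (fun s => l2norm μ (X (s + 1) - X s - ∑ n ∈ Finset.range N, Y n (s + 1)) ^ 2)
      (l2norm μ (x - ∑ n ∈ Finset.range N, z n) ^ 2) := by
    intro N
    rw [hasSum_iff_tendsto_nat_of_nonneg fun s => sq_nonneg _]
    simp_rw [← l2norm_residual_sq hX hX0 hL hY]
    exact (hlimR N).pow 2
  -- This interchanges N → ∞ with the limit in time. Each squared residual is at most the squared
  -- norm of the increment of X, by the norm identity, and the latter are summable by `hXsum`.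
  have hr : Tendsto (fun N => l2norm μ (x - ∑ n ∈ Finset.range N, z n) ^ 2) atTop (𝓝 0) := by
    simp_rw [← (hRsum _).tsum_eq]
    rw [← tsum_zero (α := ℝ) (β := ℕ)]
    refine tendsto_tsum_of_dominated_convergence hXsum.summable
      (tendsto_l2norm_increment_residual_sq hL hY) (Eventually.of_forall fun N s => ?_)
    rw [Real.norm_of_nonneg (sq_nonneg _), (hY s).norm_sq N]
    exact le_add_of_nonneg_right (Finset.sum_nonneg fun n _ => sq_nonneg _)
  exact ⟨(tendsto_l2norm_sq_zero_iff hrL).1 hr,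
    hasSum_of_forall_eq_add_sum_range (fun n => sq_nonneg _) hsum hr⟩

end Decomposition

theorem theorem3 {Ω : Type*} {mΩ : MeasurableSpace Ω} (μ : Measure Ω) [IsProbabilityMeasure μ]
    (ℱ : Filtration ℕ mΩ) (hℱ : HasAtomlessInnovations μ ℱ) (m : ℕ)
    (X : ℕ → Ω → EuclideanSpace ℝ (Fin m)) (hX : Martingale X ℱ μ) (hX0 : X 0 =ᵐ[μ] 0)
    (hbdd : L2Bounded μ X) :
    -- the `L²`-bounded martingale `X` has a terminal value
    ∃ Xinf : Ω → EuclideanSpace ℝ (Fin m), IsTerminalValue μ ℱ X Xinf ∧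
      -- the increments of `X` can be expanded into independent parts `Y^n_k`
      (∃ Y : ℕ → ℕ → Ω → EuclideanSpace ℝ (Fin m), ∀ k,
        IsIndepExpansion μ (ℱ k) (ℱ (k + 1)) (X (k + 1) - X k) (fun n => Y n (k + 1))) ∧
      -- successive best approximation by independent variables yields such an expansion
      (∀ Y : ℕ → ℕ → Ω → EuclideanSpace ℝ (Fin m),
        (∀ k, IsGreedyExpansion μ (ℱ k) (ℱ (k + 1)) (X (k + 1) - X k) (fun n => Y n (k + 1))) →
        ∀ k, IsIndepExpansion μ (ℱ k) (ℱ (k + 1)) (X (k + 1) - X k) (fun n => Y n (k + 1))) ∧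
      -- for every such expansion the martingales `Z^n_k = ∑_{s ≤ k} Y^n_s` behave as claimed
      (∀ Y : ℕ → ℕ → Ω → EuclideanSpace ℝ (Fin m),
        (∀ k, IsIndepExpansion μ (ℱ k) (ℱ (k + 1)) (X (k + 1) - X k) (fun n => Y n (k + 1))) →
        IsIndepIncrementDecomposition μ ℱ X (fun n => sumProcess (Y n)) ∧
        (∀ n, L2Bounded μ (sumProcess (Y n))) ∧
        ∃ Zinf : ℕ → Ω → EuclideanSpace ℝ (Fin m),
          (∀ n, IsTerminalValue μ ℱ (sumProcess (Y n)) (Zinf n)) ∧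
          HasL2Sum μ Zinf Xinf ∧
          HasSum (fun n => l2norm μ (Zinf n) ^ 2) (l2norm μ Xinf ^ 2)) := by
  have hL := hbdd.memLp hX
  obtain ⟨Xinf, hXinf⟩ := exists_isTerminalValue hX hbdd
  have hξ : ∀ k, MemLp (X (k + 1) - X k) 2 μ := fun k => (hL (k + 1)).sub (hL k)
  have hξm : ∀ k, StronglyMeasurable[ℱ (k + 1)] (X (k + 1) - X k) := fun k =>
    (hX.stronglyAdapted (k + 1)).sub ((hX.stronglyAdapted k).mono (ℱ.mono (Nat.le_succ k)))
  have hξc : ∀ k, μ[X (k + 1) - X k | ℱ k] =ᵐ[μ] 0 := fun k =>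
    hX.condExp_sub_eq_zero (Nat.le_succ k)
  choose U hU hUlaw hUind using hℱ
  refine ⟨Xinf, hXinf, ?_, fun Y hY k => ?_, fun Y hY => ?_⟩
  · choose η hη using fun k => exists_isIndepExpansion (ℱ.mono (Nat.le_succ k)) (ℱ.le (k + 1))
      (hU k) (hUlaw k) (hUind k) (hξ k) (hξm k) (hξc k)
    -- `η k` expands the increment from k to k + 1 and is stored at index k + 1. Truncated
    -- subtraction puts an irrelevant value at index 0.
    exact ⟨fun n k => η (k - 1) n, hη⟩
  · exact (hY k).isIndepExpansion (ℱ.mono (Nat.le_succ k)) (ℱ.le (k + 1))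
      (hU k) (hUlaw k) (hUind k) (hξ k) (hξm k) (hξc k)
  · have hb := boundedness_of_sumProcess hX hX0 hbdd hY
    choose Zinf hZinf using fun n => exists_isTerminalValue (martingale_sumProcess hY n) (hb n)
    exact ⟨isIndepIncrementDecomposition_sumProcess hX hX0 hL hY, hb, Zinf, hZinf,
      hasL2Sum_terminalValue hX hX0 hbdd hY hXinf hZinf⟩
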